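/- Let $m,n$ be nonzero integers, $d=\gcd(m,n)$, and $G_{m,n}=\langle x,y\mid x^m=y^n\rangle$. Let $R(G_{m,n})=\operatorname{Hom}(G_{m,n},SL(2,\mathbb C))$, regarded via $\rho\mapsto(\rho(x),\rho(y))$ as an affine algebraic subset of $\mathbb C^8$ with its Zariski topology, and let $t:R(G_{m,n})\to\mathbb C^3$, $t(\rho)=(\operatorname{tr}\rho(x),\operatorname{tr}\rho(y),\operatorname{tr}\rho(xy))$, be the projection onto the character variety. A representation is called reducible if the elements of its image share an eigenvector, and irreducible otherwise. Let $\mathrm{Irr}$ be the set of irreducible representations, $\mathrm{Ab}$ the set of representations with abelian image, and $M_R$ the set of reducible representations whose image is metabelian and not abelian. Then $\overline{M_R}$ has finitely many irreducible components; their number is $2(|m|-1)(|n|-1)$ if $d$ is odd, and $2[(|m|-1)(|n|-1)+1]$ if $d$ is even. Each of these components is $3$-dimensional, is birational to $PSL(2,\mathbb C)$, and is mapped by $t$ to a single point, which lies in $t(\overline{\mathrm{Irr}})\cap t(\mathrm{Ab})$. Moreover, for each of these components there are exactly two components (itself included) that $t$ maps to the same point. -/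

import Mathlib

open scoped Topology MatrixGroups

/-! ### The Zariski topology on affine space -/

/-- The Zariski topology on `ℂ^σ`: the closed sets are the common zero loci of sets of
polynomials. It is not an instance, since `σ → ℂ` carries the product topology in Mathlib. -/
abbrev zariskiTopology (σ : Type) : TopologicalSpace (σ → ℂ) :=
  TopologicalSpace.ofClosed
    {Z | ∃ I : Set (MvPolynomial σ ℂ), Z = {x | ∀ p ∈ I, MvPolynomial.eval x p = 0}}
    ⟨{1}, by ext x; simp⟩
    (by
      intro A hA
      refine ⟨{p | ∃ Z ∈ A, ∀ x ∈ Z, MvPolynomial.eval x p = 0}, ?_⟩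
      ext x
      constructor
      · rintro hx p ⟨Z, hZ, hp⟩
        exact hp x (hx Z hZ)
      · intro hx Z hZ
        obtain ⟨I, rfl⟩ := hA hZ
        exact fun p hp => hx p ⟨_, hZ, fun y hy => hy p hp⟩)
    (by
      rintro _ ⟨I, rfl⟩ _ ⟨J, rfl⟩
      refine ⟨{r | ∃ p ∈ I, ∃ q ∈ J, r = p * q}, ?_⟩
      ext x
      constructor
      · rintro (h | h) r ⟨p, hp, q, hq, rfl⟩
        · simp [h p hp]
        · simp [h q hq]
      · intro h
        by_contra hc
        simp only [Set.mem_union, Set.mem_ofPred_eq, not_or, not_forall] at hc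
        obtain ⟨⟨p, hp, hp0⟩, ⟨q, hq, hq0⟩⟩ := hc
        have h1 := h (p * q) ⟨p, hp, q, hq, rfl⟩
        rw [map_mul] at h1
        exact (mul_ne_zero hp0 hq0) h1)

/-- The closed sets of `zariskiTopology` are the zero loci. -/
theorem isClosed_zariskiTopology_iff {σ : Type} (Z : Set (σ → ℂ)) :
    IsClosed[zariskiTopology σ] Z ↔
      ∃ I : Set (MvPolynomial σ ℂ), Z = {x | ∀ p ∈ I, MvPolynomial.eval x p = 0} := by
  rw [← @isOpen_compl_iff _ _ (zariskiTopology σ)]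
  change Zᶜᶜ ∈ _ ↔ _
  rw [compl_compl]
  rfl

/-- The irreducible components of a subset `S` of a topological space, `S` having the subspace
topology, as subsets of the ambient space. -/
def irredComponentsOf {X : Type} [TopologicalSpace X] (S : Set X) : Set (Set X) :=
  (fun Z : Set S => Subtype.val '' Z) '' irreducibleComponents S

/-! ### Regular maps and birational equivalence -/

/-- `f` is regular on `U ⊆ ℂ^σ`: near every point of `U`, each coordinate of `f` is a quotient of
two polynomials whose denominator does not vanish. -/
def IsRegularOn {σ τ : Type} (f : (σ → ℂ) → (τ → ℂ)) (U : Set (σ → ℂ)) : Prop :=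
  ∀ x ∈ U, ∀ j : τ, ∃ p q : MvPolynomial σ ℂ, MvPolynomial.eval x q ≠ 0 ∧
    ∀ y ∈ U, MvPolynomial.eval y q ≠ 0 →
      f y j = MvPolynomial.eval y p / MvPolynomial.eval y q

/-- `U` is a Zariski open and Zariski dense subset of `Z`. -/
def IsDenseOpenIn {σ : Type} (U Z : Set (σ → ℂ)) : Prop :=
  (∃ O : Set (σ → ℂ), IsOpen[zariskiTopology σ] O ∧ U = Z ∩ O) ∧
    Z ⊆ @closure _ (zariskiTopology σ) U

/-- `Z ⊆ ℂ^σ` and `W ⊆ ℂ^τ` are birational: dense open subsets of them are isomorphic through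
mutually inverse regular maps. -/
def AreBirational {σ τ : Type} (Z : Set (σ → ℂ)) (W : Set (τ → ℂ)) : Prop :=
  ∃ (U : Set (σ → ℂ)) (V : Set (τ → ℂ)) (f : (σ → ℂ) → (τ → ℂ)) (g : (τ → ℂ) → (σ → ℂ)),
    IsDenseOpenIn U Z ∧ IsDenseOpenIn V W ∧
    IsRegularOn f U ∧ IsRegularOn g V ∧
    Set.MapsTo f U V ∧ Set.MapsTo g V U ∧
    Set.LeftInvOn g f U ∧ Set.RightInvOn g f V

/-! ### `PSL(2, ℂ)` as an affine variety -/

/-- The closed embedding of `PSL(2, ℂ) = SL(2, ℂ) / {± 1}` in `ℂ^16` by the products of two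
matrix entries; these products generate the ring of the regular functions on `SL(2, ℂ)` that are
invariant under `A ↦ -A`, which is the coordinate ring of `PSL(2, ℂ)`. -/
def pslCoord : PSL(2, ℂ) → ((Fin 2 × Fin 2) × (Fin 2 × Fin 2) → ℂ) :=
  Quotient.lift (fun A : SL(2, ℂ) => fun k => A.1 k.1.1 k.1.2 * A.1 k.2.1 k.2.2) (by
    intro A B h
    rw [← Quotient.eq_iff_equiv, Quotient.eq, QuotientGroup.leftRel_apply,
      Matrix.SpecialLinearGroup.mem_center_iff] at h
    obtain ⟨r, hr, h⟩ := h
    have hB : B.1 = r • A.1 := by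
      have h2 : B = A * (A⁻¹ * B) := by group
      rw [h2, Matrix.SpecialLinearGroup.coe_mul, ← h]
      ext i j
      simp [mul_comm]
    have hr2 : r * r = 1 := by simpa [pow_two] using hr
    funext k
    simp only [hB, Matrix.smul_apply, smul_eq_mul]
    linear_combination (-(A.1 k.1.1 k.1.2 * A.1 k.2.1 k.2.2)) * hr2)

theorem pslCoord_injective : Function.Injective pslCoord := by
  intro x y
  refine Quotient.inductionOn₂ x y ?_
  intro A B h
  have h' : ∀ i j k l, A.1 i j * A.1 k l = B.1 i j * B.1 k l :=
    fun i j k l => congrFun h ((i, j), (k, l))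
  obtain ⟨i, j, hij⟩ : ∃ i j, A.1 i j ≠ 0 := by
    by_contra hc
    push Not at hc
    have h1 := A.2
    rw [Matrix.det_fin_two] at h1
    simp [hc] at h1
  have hb : B.1 i j ≠ 0 := fun h0 => by
    have h1 := h' i j i j
    rw [h0, zero_mul] at h1
    exact (mul_ne_zero hij hij) h1
  have hr2 : (B.1 i j / A.1 i j) ^ 2 = 1 := by
    have h1 := h' i j i j
    field_simp
    linear_combination -h1
  have hB : B.1 = (B.1 i j / A.1 i j) • A.1 := by
    ext k l
    have h1 := h' i j i j
    have h2 := h' i j k l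
    rw [Matrix.smul_apply, smul_eq_mul]
    field_simp
    apply mul_left_cancel₀ hb
    linear_combination (-(A.1 i j)) * h2 + A.1 k l * h1
  rw [Quotient.eq, QuotientGroup.leftRel_apply, Matrix.SpecialLinearGroup.mem_center_iff]
  refine ⟨B.1 i j / A.1 i j, by simpa using hr2, ?_⟩
  rw [Matrix.SpecialLinearGroup.coe_mul, hB, Matrix.mul_smul, ← Matrix.SpecialLinearGroup.coe_mul,
    inv_mul_cancel, Matrix.SpecialLinearGroup.coe_one, ← hB]
  ext k l
  simp [Matrix.smul_apply, Matrix.one_apply, Matrix.diagonal_apply]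

/-- `PSL(2, ℂ)` as an affine algebraic set. -/
def pslVariety : Set ((Fin 2 × Fin 2) × (Fin 2 × Fin 2) → ℂ) := Set.range pslCoord

/-! ### The group `G_{m,n}` and its representations in `SL(2, ℂ)` -/

/-- The group `G_{m,n} = ⟨x, y ∣ x^m = y^n⟩`. -/
abbrev TorusGroup (m n : ℤ) : Type :=
  PresentedGroup ({FreeGroup.of 0 ^ m * (FreeGroup.of 1 ^ n)⁻¹} : Set (FreeGroup (Fin 2)))

namespace TorusGroup

/-- The two generators: `gen m n 0` is `x` and `gen m n 1` is `y`. -/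
def gen (m n : ℤ) (k : Fin 2) : TorusGroup m n := PresentedGroup.of k

/-- `R(G_{m,n})`: the representations of `G_{m,n}` in `SL(2, ℂ)`. -/
abbrev Rep (m n : ℤ) : Type := TorusGroup m n →* SL(2, ℂ)

/-- The embedding `ρ ↦ (ρ(x), ρ(y))` of `R(G_{m,n})` in `ℂ^8`. -/
def coords {m n : ℤ} (ρ : Rep m n) : Fin 2 × Fin 2 × Fin 2 → ℂ :=
  fun k => (ρ (gen m n k.1)).1 k.2.1 k.2.2

/-- The Zariski topology on `R(G_{m,n})`, as a subset of `ℂ^8`. -/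
instance repTopology (m n : ℤ) : TopologicalSpace (Rep m n) :=
  (zariskiTopology (Fin 2 × Fin 2 × Fin 2)).induced coords

/-- `ρ` is reducible: the elements of the image share an eigenvector. -/
def IsReducible {m n : ℤ} (ρ : Rep m n) : Prop :=
  ∃ v : Fin 2 → ℂ, v ≠ 0 ∧ ∀ g, ∃ c : ℂ, Matrix.mulVec (ρ g).1 v = c • v

/-- `ρ` has abelian image. -/
def HasAbelianImage {m n : ℤ} (ρ : Rep m n) : Prop :=
  ∀ g h, ρ g * ρ h = ρ h * ρ g

/-- The set of the irreducible representations. -/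
def irr (m n : ℤ) : Set (Rep m n) := {ρ | ¬ IsReducible ρ}

/-- The set of the representations with abelian image. -/
def ab (m n : ℤ) : Set (Rep m n) := {ρ | HasAbelianImage ρ}

/-- `M_R`: the set of the reducible representations with metabelian, non-abelian image. -/
def redMetabelian (m n : ℤ) : Set (Rep m n) :=
  {ρ | IsReducible ρ ∧ derivedSeries ρ.range 2 = ⊥ ∧ ¬ HasAbelianImage ρ}

/-- The projection `t : R(G_{m,n}) → ℂ^3`, `t(ρ) = (tr ρ(x), tr ρ(y), tr ρ(xy))`, whose image is
the character variety. -/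
def charMap {m n : ℤ} (ρ : Rep m n) : Fin 3 → ℂ :=
  ![(ρ (gen m n 0)).1.trace, (ρ (gen m n 1)).1.trace, (ρ (gen m n 0 * gen m n 1)).1.trace]

end TorusGroup

-- Write X and Y for the images of x and y. Let ρ be reducible and not abelian, with a common
-- eigenvector of eigenvalues a for X and c for Y. The matrix X^m = Y^n commutes with X and Y. If X
-- or Y were a linear combination of it and the identity, then X and Y would commute. By
-- Cayley–Hamilton this happens unless a, c ≠ ±1 and a^m = c^n = ±1 (`eigenvalue_cases`,
-- `exists_eigenPair`). Conversely, for such a pair p = (a, c) every matrix with eigenvalues a and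
-- a⁻¹ has m-th power a^m, and likewise for c, so the relation only depends on the traces.
--
-- The representations attached to p are thus free choices of an eigenline and of two matrices
-- acting on it with prescribed eigenvalues. They form the closed set `redComponent m n p`: its
-- equation (Y - c)(X - a⁻¹) = 0 says that the image of X - a⁻¹, the a-eigenline of X, consists of
-- c-eigenvectors of Y. The polynomial map `chart` from ℂ³ has dense image in it and a rational
-- inverse (`eq_chart`), which gives irreducibility, dimension 3 and, after a rational change of
-- coordinates, a birational map to PSL(2, ℂ). Nonabelian points are open and present in each set,
-- so the closure of M_R is the finite union of these sets.
--
-- On each set all three traces are constant, and they determine p up to p ↦ p⁻¹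
-- (`image_charMap_eq_iff`). Hence the sets are pairwise incomparable, they are the components, and
-- t identifies them two by two. Over the common point there is a diagonal representation, and a
-- triangular one that is a limit of irreducible ones. The number of components is the number of
-- pairs p, a count of roots of 1 and -1 with ±1 removed.

/-! ### Polynomial functions and the Zariski topology -/

/-- `f` is given by a polynomial. -/
@[fun_prop]
def IsPolynomialFun {σ : Type} (f : (σ → ℂ) → ℂ) : Prop :=
  ∃ p : MvPolynomial σ ℂ, ∀ x, MvPolynomial.eval x p = f x

namespace IsPolynomialFun

variable {σ : Type} {f g : (σ → ℂ) → ℂ}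

@[fun_prop]
theorem const (c : ℂ) : IsPolynomialFun fun _ : σ → ℂ => c := ⟨MvPolynomial.C c, by simp⟩

@[fun_prop]
theorem coord (i : σ) : IsPolynomialFun fun x : σ → ℂ => x i := ⟨MvPolynomial.X i, by simp⟩

@[fun_prop]
theorem add (hf : IsPolynomialFun f) (hg : IsPolynomialFun g) :
    IsPolynomialFun fun x => f x + g x := by
  obtain ⟨p, hp⟩ := hf
  obtain ⟨q, hq⟩ := hg
  exact ⟨p + q, by simp [hp, hq]⟩

@[fun_prop]
theorem mul (hf : IsPolynomialFun f) (hg : IsPolynomialFun g) :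
    IsPolynomialFun fun x => f x * g x := by
  obtain ⟨p, hp⟩ := hf
  obtain ⟨q, hq⟩ := hg
  exact ⟨p * q, by simp [hp, hq]⟩

@[fun_prop]
theorem neg (hf : IsPolynomialFun f) : IsPolynomialFun fun x => -f x := by
  obtain ⟨p, hp⟩ := hf
  exact ⟨-p, by simp [hp]⟩

@[fun_prop]
theorem sub (hf : IsPolynomialFun f) (hg : IsPolynomialFun g) :
    IsPolynomialFun fun x => f x - g x := by
  obtain ⟨p, hp⟩ := hf
  obtain ⟨q, hq⟩ := hg
  exact ⟨p - q, by simp [hp, hq]⟩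

@[fun_prop]
theorem pow (hf : IsPolynomialFun f) (n : ℕ) : IsPolynomialFun fun x => f x ^ n := by
  obtain ⟨p, hp⟩ := hf
  exact ⟨p ^ n, by simp [hp]⟩

/-- Polynomials in polynomial functions are polynomial functions. -/
theorem eval_comp {τ : Type} {F : (σ → ℂ) → (τ → ℂ)}
    (hF : ∀ j, IsPolynomialFun fun x => F x j) (p : MvPolynomial τ ℂ) :
    IsPolynomialFun fun x => MvPolynomial.eval (F x) p := by
  choose P hP using hF
  refine ⟨MvPolynomial.bind₁ P p, fun x => ?_⟩
  have : F x = fun j => MvPolynomial.eval x (P j) := funext fun j => (hP j x).symm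
  beta_reduce
  rw [this, MvPolynomial.eval, MvPolynomial.eval₂Hom_bind₁]
  rfl

/-- A polynomial in quotients of polynomial functions by `q` is such a quotient, up to a power
of `q`. -/
theorem exists_clear_denominators {τ : Type} {F : (σ → ℂ) → (τ → ℂ)} {q : (σ → ℂ) → ℂ}
    (hq : IsPolynomialFun q) (hF : ∀ j, IsPolynomialFun fun x => F x j) (p : MvPolynomial τ ℂ) :
    ∃ (r : (σ → ℂ) → ℂ) (N : ℕ), IsPolynomialFun r ∧ ∀ (x : σ → ℂ) (y : τ → ℂ),
      (∀ j, y j * q x = F x j) → r x = q x ^ N * MvPolynomial.eval y p := by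
  induction p using MvPolynomial.induction_on with
  | C c => exact ⟨fun _ => c, 0, by fun_prop, by simp⟩
  | add p p' hp hp' =>
    obtain ⟨r, N, hr, h⟩ := hp
    obtain ⟨r', N', hr', h'⟩ := hp'
    refine ⟨fun x => r x * q x ^ N' + r' x * q x ^ N, N + N', by fun_prop, fun x y hy => ?_⟩
    simp only [h x y hy, h' x y hy, map_add]
    ring
  | mul_X p j hp =>
    obtain ⟨r, N, hr, h⟩ := hp
    refine ⟨fun x => r x * F x j, N + 1, hr.mul (hF j), fun x y hy => ?_⟩
    simp only [h x y hy, ← hy j, map_mul, MvPolynomial.eval_X]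
    ring

end IsPolynomialFun

section Zariski

attribute [local instance] zariskiTopology

namespace zariskiTopology

variable {σ τ : Type}

theorem isClosed_iff {Z : Set (σ → ℂ)} : IsClosed Z ↔
    ∃ I : Set (MvPolynomial σ ℂ), Z = {x | ∀ p ∈ I, MvPolynomial.eval x p = 0} :=
  isClosed_zariskiTopology_iff Z

theorem isClosed_eq_zero {f : (σ → ℂ) → ℂ} (hf : IsPolynomialFun f) :
    IsClosed {x : (σ → ℂ) | f x = 0} := by
  obtain ⟨p, hp⟩ := hf
  exact isClosed_iff.2 ⟨{p}, by ext x; simp [hp x]⟩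

theorem isOpen_ne_zero {f : (σ → ℂ) → ℂ} (hf : IsPolynomialFun f) :
    IsOpen {x : (σ → ℂ) | f x ≠ 0} :=
  (isClosed_eq_zero hf).isOpen_compl

theorem continuous_of_isClosed {X : Type} [TopologicalSpace X] {f : X → (σ → ℂ)}
    (h : ∀ p : MvPolynomial σ ℂ, IsClosed {x | MvPolynomial.eval (f x) p = 0}) :
    Continuous f := by
  refine continuous_iff_isClosed.2 fun Z hZ => ?_
  obtain ⟨I, rfl⟩ := isClosed_iff.1 hZ
  have : f ⁻¹' {x | ∀ p ∈ I, MvPolynomial.eval x p = 0} =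
      ⋂ p ∈ I, {x | MvPolynomial.eval (f x) p = 0} := by
    ext x; simp
  rw [this]
  exact isClosed_biInter fun p _ => h p

theorem continuous_of_polynomial {f : (σ → ℂ) → (τ → ℂ)}
    (hf : ∀ j, IsPolynomialFun fun x : σ → ℂ => f x j) : Continuous f :=
  continuous_of_isClosed fun p => isClosed_eq_zero (IsPolynomialFun.eval_comp hf p)

/-- A map whose coordinates are quotients of polynomials with a common denominator is
continuous. -/
theorem continuous_of_rational {X : Type} [TopologicalSpace X] {g : X → (σ → ℂ)}
    (hg : Continuous g) {f : X → (τ → ℂ)} {q : (σ → ℂ) → ℂ} {F : (σ → ℂ) → (τ → ℂ)}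
    (hq : IsPolynomialFun q) (hF : ∀ j, IsPolynomialFun fun x => F x j)
    (hq0 : ∀ x, q (g x) ≠ 0) (h : ∀ x j, f x j * q (g x) = F (g x) j) : Continuous f := by
  refine continuous_of_isClosed fun p => ?_
  obtain ⟨r, N, hr, hrN⟩ := IsPolynomialFun.exists_clear_denominators hq hF p
  convert (isClosed_eq_zero hr).preimage hg using 1
  ext x
  simp [hrN (g x) (f x) (h x), hq0 x]

/-- The polynomial ring is a domain, and a polynomial that vanishes on all of ℂ^σ is zero because ℂ
is infinite. -/
instance irreducibleSpace (σ : Type) : IrreducibleSpace (σ → ℂ) := by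
  rw [irreducibleSpace_def]
  refine ⟨Set.univ_nonempty, isPreirreducible_iff_isClosed_union_isClosed.2 ?_⟩
  intro Z W hZ hW h
  obtain ⟨I, rfl⟩ := isClosed_iff.1 hZ
  obtain ⟨J, rfl⟩ := isClosed_iff.1 hW
  by_contra! hc
  obtain ⟨h1, h2⟩ := hc
  obtain ⟨x, -, hx⟩ := Set.not_subset.1 h1
  obtain ⟨y, -, hy⟩ := Set.not_subset.1 h2
  simp only [Set.mem_ofPred_eq, not_forall] at hx hy
  obtain ⟨p, hp, hpx⟩ := hx
  obtain ⟨q, hq, hqy⟩ := hy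
  have hpq : p * q = 0 := by
    refine MvPolynomial.funext fun z => ?_
    rcases h (Set.mem_univ z) with hz | hz
    · simp [show MvPolynomial.eval z p = 0 from hz p hp]
    · simp [show MvPolynomial.eval z q = 0 from hz q hq]
  rcases mul_eq_zero.1 hpq with h0 | h0
  · exact hpx (by rw [h0, map_zero])
  · exact hqy (by rw [h0, map_zero])

/-- Sending a point to the ideal of polynomials vanishing there makes the Zariski topology induced
from the prime spectrum, so the Krull dimension of the polynomial ring is a bound. -/
theorem topologicalKrullDim_le (n : ℕ) : topologicalKrullDim (Fin n → ℂ) ≤ n := by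
  let f : (Fin n → ℂ) → PrimeSpectrum (MvPolynomial (Fin n) ℂ) :=
    fun x => ⟨RingHom.ker (MvPolynomial.eval x), RingHom.ker_isPrime _⟩
  have hf : Topology.IsInducing f := by
    refine ⟨le_antisymm ?_ ?_⟩
    · refine continuous_iff_le_induced.1 (continuous_iff_isClosed.2 fun Z hZ => ?_)
      obtain ⟨I, rfl⟩ := (PrimeSpectrum.isClosed_iff_zeroLocus Z).1 hZ
      exact isClosed_iff.2 ⟨I, by ext x; rfl⟩
    · intro U hU
      obtain ⟨I, hI⟩ := isClosed_iff.1 (isClosed_compl_iff.2 hU)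
      refine ⟨(PrimeSpectrum.zeroLocus I)ᶜ, (PrimeSpectrum.isClosed_zeroLocus I).isOpen_compl, ?_⟩
      rw [← compl_inj_iff, hI]
      ext x
      simp only [Set.preimage_compl, compl_compl]
      rfl
  refine hf.topologicalKrullDim_le.trans ?_
  rw [PrimeSpectrum.topologicalKrullDim_eq_ringKrullDim,
    MvPolynomial.ringKrullDim_of_isNoetherianRing]
  simp

end zariskiTopology

end Zariski

-- Irreducible sets, components and dimension in topological spaces

/-- A continuous map from an irreducible space maps everything into the closure of the image of
a nonempty open set. -/
theorem Continuous.mem_closure_of_isOpen {X Y : Type} [TopologicalSpace X] [PreirreducibleSpace X]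
    [TopologicalSpace Y] {f : X → Y} (hf : Continuous f) {U : Set X} (hU : IsOpen U)
    (hne : U.Nonempty) {S : Set Y} (h : ∀ x ∈ U, f x ∈ S) (x : X) : f x ∈ closure S :=
  map_mem_closure hf (hU.dense hne x) h

theorem isIrreducible_image_val_iff {X : Type} [TopologicalSpace X] {S : Set X} {T : Set S} :
    IsIrreducible (Subtype.val '' T) ↔ IsIrreducible T := by
  refine ⟨fun h => ⟨h.nonempty.of_image, ?_⟩,
    fun h => h.image _ continuous_subtype_val.continuousOn⟩
  rintro _ _ ⟨U, hU, rfl⟩ ⟨W, hW, rfl⟩ ⟨x, hx, hxU⟩ ⟨y, hy, hyW⟩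
  obtain ⟨_, ⟨z, hz, rfl⟩, hzU, hzW⟩ :=
    h.2 U W hU hW ⟨x, ⟨x, hx, rfl⟩, hxU⟩ ⟨y, ⟨y, hy, rfl⟩, hyW⟩
  exact ⟨z, hz, hzU, hzW⟩

/-- The irreducible components of `S` as maximal irreducible subsets of the ambient space. -/
theorem mem_irredComponentsOf_iff {X : Type} [TopologicalSpace X] {S Z : Set X} :
    Z ∈ irredComponentsOf S ↔ Maximal (fun T => IsIrreducible T ∧ T ⊆ S) Z := by
  have himg {W : Set X} (hW : W ⊆ S) : Subtype.val '' (Subtype.val ⁻¹' W : Set S) = W := by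
    rw [Subtype.image_preimage_coe, Set.inter_eq_right.2 hW]
  constructor
  · rintro ⟨T, hT, rfl⟩
    refine ⟨⟨isIrreducible_image_val_iff.2 hT.1, Subtype.coe_image_subset S T⟩,
      fun W hW hle => ?_⟩
    have h : IsIrreducible (Subtype.val ⁻¹' W : Set S) := by
      rw [← isIrreducible_image_val_iff, himg hW.2]
      exact hW.1
    have h2 := hT.2 h (Set.image_subset_iff.1 hle)
    rw [← himg hW.2]
    exact Set.image_mono h2
  · rintro ⟨⟨hZ, hZS⟩, hmax⟩
    refine ⟨Subtype.val ⁻¹' Z, ⟨?_, fun W hW hle => ?_⟩, himg hZS⟩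
    · rw [← isIrreducible_image_val_iff, himg hZS]
      exact hZ
    · refine Set.image_subset_iff.1 (hmax ⟨isIrreducible_image_val_iff.2 hW,
        Subtype.coe_image_subset S W⟩ ?_)
      rw [← himg hZS]
      exact Set.image_mono hle

/-- The irreducible components of a finite union of pairwise incomparable closed irreducible
sets. -/
theorem irredComponentsOf_biUnion {X ι : Type} [TopologicalSpace X] {I : Set ι} (hI : I.Finite)
    {V : ι → Set X} (hc : ∀ i ∈ I, IsClosed (V i)) (hV : ∀ i ∈ I, IsIrreducible (V i))
    (hne : ∀ i ∈ I, ∀ j ∈ I, V i ⊆ V j → i = j) :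
    irredComponentsOf (⋃ i ∈ I, V i) = V '' I := by
  classical
  have key {Z : Set X} (hZ : IsIrreducible Z) (h : Z ⊆ ⋃ i ∈ I, V i) : ∃ i ∈ I, Z ⊆ V i := by
    obtain ⟨z, hz, hZz⟩ := isIrreducible_iff_sUnion_isClosed.1 hZ (hI.toFinset.image V)
      (by simpa using hc) (by simpa using h)
    obtain ⟨i, hi, rfl⟩ := Finset.mem_image.1 hz
    exact ⟨i, hI.mem_toFinset.1 hi, hZz⟩
  ext Z
  rw [mem_irredComponentsOf_iff]
  constructor
  · rintro ⟨⟨hZ, hZS⟩, hmax⟩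
    obtain ⟨i, hi, hle⟩ := key hZ hZS
    exact ⟨i, hi, (hmax ⟨hV i hi, Set.subset_biUnion_of_mem hi⟩ hle).antisymm hle⟩
  · rintro ⟨i, hi, rfl⟩
    refine ⟨⟨hV i hi, Set.subset_biUnion_of_mem hi⟩, fun W hW hle => ?_⟩
    obtain ⟨j, hj, hWj⟩ := key hW.1 hW.2
    obtain rfl := hne i hi j hj (hle.trans hWj)
    exact hWj

/-- The dimension of a space is bounded by that of the members of an open cover. -/
theorem topologicalKrullDim_le_of_isOpen_cover {X ι : Type} [TopologicalSpace X] {U : ι → Set X}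
    (hU : ∀ i, IsOpen (U i)) (hcov : ∀ x, ∃ i, x ∈ U i) {n : WithBot ℕ∞}
    (h : ∀ i, topologicalKrullDim (U i) ≤ n) : topologicalKrullDim X ≤ n := by
  rw [topologicalKrullDim]
  rw [Order.krullDim_eq_iSup_coheight]
  refine iSup_le fun Z => ?_
  obtain ⟨x, hx⟩ := Z.isIrreducible.nonempty
  obtain ⟨i, hi⟩ := hcov x
  -- Every irreducible closed set above `Z` also meets `U i`, so the coheight of `Z` can be computed
  -- inside `U i`.
  have hemb := (hU i).isOpenEmbedding_subtypeVal
  obtain ⟨T, hT⟩ := (TopologicalSpace.IrreducibleCloseds.orderIsoOfIsOpenEmbedding _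
    hemb).surjective ⟨Z, ⟨⟨x, hi⟩, hx⟩⟩
  have hZ : TopologicalSpace.IrreducibleCloseds.map _ hemb.continuous T = Z :=
    congrArg Subtype.val hT
  rw [← hZ, hemb.coheight_map]
  exact (Order.coheight_le_krullDim T).trans (h i)

/-- A strict chain of closures of irreducible sets bounds the dimension from below. -/
theorem le_topologicalKrullDim_of_chain {X : Type} [TopologicalSpace X] {n : ℕ}
    (T : Fin (n + 1) → Set X) (hT : ∀ i, IsIrreducible (T i))
    (hle : ∀ i : Fin n, T i.castSucc ⊆ T i.succ)
    (hlt : ∀ i : Fin n, ∃ C, IsClosed C ∧ T i.castSucc ⊆ C ∧ ¬ T i.succ ⊆ C) :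
    (n : WithBot ℕ∞) ≤ topologicalKrullDim X := by
  let l : LTSeries (TopologicalSpace.IrreducibleCloseds X) :=
    { length := n
      toFun := fun i => ⟨closure (T i), (hT i).closure, isClosed_closure⟩
      step := fun i => by
        obtain ⟨C, hC, h1, h2⟩ := hlt i
        refine lt_of_le_not_ge (closure_mono (hle i) : closure _ ⊆ closure _) fun h => ?_
        have h : closure (T i.succ) ⊆ closure (T i.castSucc) := h
        exact h2 (subset_closure.trans (h.trans (hC.closure_subset_iff.2 h1))) }
  exact Order.LTSeries.length_le_krullDim l

/-! ### Two by two matrices -/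

namespace Matrix.SpecialLinearGroup

theorem mul_self_eq_trace_smul_sub_one {X : Matrix (Fin 2) (Fin 2) ℂ} (hdet : X.det = 1) :
    X * X = X.trace • X - (1 : Matrix (Fin 2) (Fin 2) ℂ) := by
  rw [Matrix.det_fin_two] at hdet
  ext i j
  fin_cases i <;> fin_cases j <;> simp [Matrix.mul_apply, Matrix.trace_fin_two] <;>
    first | linear_combination -hdet | ring

/-- Powers of a matrix with eigenvalues `a` and `a⁻¹`. -/
theorem sub_smul_pow {X : Matrix (Fin 2) (Fin 2) ℂ} {a : ℂˣ} (hdet : X.det = 1)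
    (htr : X.trace = a + ↑a⁻¹) (k : ℕ) :
    ((a : ℂ) - ↑a⁻¹) • X ^ k =
      ((a : ℂ) ^ k - (↑a⁻¹ : ℂ) ^ k) • X -
        ((a : ℂ) ^ k * ↑a⁻¹ - (↑a⁻¹ : ℂ) ^ k * a) • (1 : Matrix (Fin 2) (Fin 2) ℂ) := by
  have hsq := mul_self_eq_trace_smul_sub_one hdet
  have ha : (a : ℂ) * ↑a⁻¹ = 1 := a.mul_inv
  induction k with
  | zero => simp only [pow_zero]; module
  | succ k ih =>
    rw [pow_succ, ← smul_mul_assoc, ih, sub_mul, smul_mul_assoc, hsq, smul_mul_assoc, one_mul, htr]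
    ext i j
    simp only [Matrix.sub_apply, Matrix.smul_apply, smul_eq_mul]
    linear_combination ((a : ℂ) ^ k - (↑a⁻¹ : ℂ) ^ k) * (1 : Matrix (Fin 2) (Fin 2) ℂ) i j * ha

/-- Powers of a matrix with the double eigenvalue `a`. -/
theorem smul_pow_of_sq_eq_one {X : Matrix (Fin 2) (Fin 2) ℂ} {a : ℂ} (hdet : X.det = 1)
    (htr : X.trace = 2 * a) (ha : a ^ 2 = 1) (k : ℕ) :
    a • X ^ k =
      (k * a ^ k) • X - ((k - 1) * a ^ (k + 1)) • (1 : Matrix (Fin 2) (Fin 2) ℂ) := by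
  have hsq := mul_self_eq_trace_smul_sub_one hdet
  induction k with
  | zero => simp
  | succ k ih =>
    rw [pow_succ, ← smul_mul_assoc, ih, sub_mul, smul_mul_assoc, hsq, smul_mul_assoc, one_mul, htr]
    ext i j
    simp only [Matrix.sub_apply, Matrix.smul_apply, smul_eq_mul]
    push_cast
    linear_combination k * a ^ k * (1 : Matrix (Fin 2) (Fin 2) ℂ) i j * ha

/-- Since ±1 are their own inverses, the sign of the exponent is irrelevant for the equations a^m =
±1. -/
theorem pow_natAbs_eq_iff {G : Type} [Group G] {g e : G} (he : e⁻¹ = e) (m : ℤ) :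
    g ^ m.natAbs = e ↔ g ^ m = e := by
  rcases m.eq_nat_or_neg with ⟨k, rfl | rfl⟩
  · simp
  · rw [_root_.zpow_neg, zpow_natCast, inv_eq_iff_eq_inv, he, Int.natAbs_neg, Int.natAbs_natCast]

theorem val_sub_inv_ne_zero {a : ℂˣ} (ha : a ^ 2 ≠ 1) : (a : ℂ) - ↑a⁻¹ ≠ 0 := by
  intro h
  refine ha ?_
  rw [pow_two]
  nth_rw 2 [Units.ext (sub_eq_zero.1 h)]
  exact mul_inv_cancel a

/-- If `a ^ m = ± 1` then a matrix with distinct eigenvalues `a` and `a⁻¹` has the scalar `m`-th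
power `± 1`. -/
theorem zpow_eq_scalar {X : SL(2, ℂ)} {a : ℂˣ} (htr : X.1.trace = a + ↑a⁻¹) (ha : a ^ 2 ≠ 1)
    {m : ℤ} (hm : (a ^ m) ^ 2 = 1) :
    (X ^ m).1 = ((a ^ m : ℂˣ) : ℂ) • (1 : Matrix (Fin 2) (Fin 2) ℂ) := by
  -- Treats e = 1 and e = -1 alike; `E` is the scalar matrix e.
  have key (e : ℂˣ) (E : SL(2, ℂ)) (hE : E.1 = (e : ℂ) • (1 : Matrix (Fin 2) (Fin 2) ℂ))
      (hE' : E⁻¹ = E) (he : e⁻¹ = e) (hae : a ^ m = e) :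
      (X ^ m).1 = ((a ^ m : ℂˣ) : ℂ) • (1 : Matrix (Fin 2) (Fin 2) ℂ) := by
    rw [hae, ← hE]
    refine congrArg Subtype.val ((pow_natAbs_eq_iff hE' m).1 (Subtype.ext ?_))
    have h1 : (a : ℂ) ^ m.natAbs = e := by
      rw [← Units.val_pow_eq_pow_val, (pow_natAbs_eq_iff he m).2 hae]
    have h2 : (↑a⁻¹ : ℂ) ^ m.natAbs = e := by
      rw [← Units.val_pow_eq_pow_val, inv_pow, (pow_natAbs_eq_iff he m).2 hae, he]
    have h3 := sub_smul_pow X.2 htr m.natAbs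
    rw [h1, h2, sub_self, zero_smul, zero_sub, ← neg_smul] at h3
    refine smul_right_injective _ (val_sub_inv_ne_zero ha) ?_
    beta_reduce
    rw [Matrix.SpecialLinearGroup.coe_pow, h3, hE, smul_smul]
    congr 1
    ring
  have h : ((a ^ m : ℂˣ) : ℂ) * ((a ^ m : ℂˣ) : ℂ) = 1 := by
    rw [← Units.val_mul, ← pow_two, hm, Units.val_one]
  rcases mul_self_eq_one_iff.1 h with h | h
  · exact key 1 1 (by simp) inv_one inv_one (Units.ext h)
  · refine key (-1) (-1) (by simp) ?_ (by simp) (Units.ext (by simpa using h))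
    rw [inv_eq_iff_mul_eq_one]
    exact Subtype.ext (by simp)

/-- The inverse is the adjugate. This turns linear combinations of X^k and 1 into combinations of
X^(-k) and 1. -/
theorem eq_trace_smul_sub_inv (g : SL(2, ℂ)) :
    g.1 = g.1.trace • (1 : Matrix (Fin 2) (Fin 2) ℂ) - (g⁻¹).1 := by
  rw [Matrix.SpecialLinearGroup.coe_inv, Matrix.adjugate_fin_two]
  ext i j
  fin_cases i <;> fin_cases j <;> simp [Matrix.trace_fin_two]

/-- Either `a ≠ ± 1` and `a ^ m = ± 1`, or a matrix `X` with eigenvalues `a` and `a⁻¹` is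
a linear combination of `X ^ m` and the identity. -/
theorem eigenvalue_cases {X : SL(2, ℂ)} {a : ℂˣ} (htr : X.1.trace = a + ↑a⁻¹) {m : ℤ}
    (hm : m ≠ 0) : (a ^ 2 ≠ 1 ∧ (a ^ m) ^ 2 = 1) ∨
      ∃ u w : ℂ, X.1 = u • (X ^ m).1 + w • (1 : Matrix (Fin 2) (Fin 2) ℂ) := by
  have key (k : ℕ) (hk : k ≠ 0) : (a ^ 2 ≠ 1 ∧ (a ^ k) ^ 2 = 1) ∨
      ∃ u w : ℂ, X.1 = u • (X ^ k).1 + w • (1 : Matrix (Fin 2) (Fin 2) ℂ) := by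
    -- Up to a nonzero factor, the coefficient of X in the formula for X^k is k a^k if a = ±1, and
    -- a^k - a⁻ᵏ otherwise. Where it is nonzero, the formula can be solved for X.
    by_cases ha : a ^ 2 = 1
    · right
      have hinv : a⁻¹ = a := by rw [inv_eq_iff_mul_eq_one, ← pow_two, ha]
      have ha' : (a : ℂ) ^ 2 = 1 := by rw [← Units.val_pow_eq_pow_val, ha, Units.val_one]
      have h := smul_pow_of_sq_eq_one X.2 (by rw [htr, hinv]; ring) ha' k
      have h0 : (k : ℂ) * (a : ℂ) ^ k ≠ 0 := by simp [hk]
      rw [eq_sub_iff_add_eq, eq_comm, ← eq_inv_smul_iff₀ h0, smul_add, smul_smul, smul_smul] at h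
      exact ⟨_, _, h⟩
    · by_cases hak : (a ^ k) ^ 2 = 1
      · exact Or.inl ⟨ha, hak⟩
      · right
        have h := sub_smul_pow X.2 htr k
        have h0 := val_sub_inv_ne_zero hak
        rw [← inv_pow, Units.val_pow_eq_pow_val, Units.val_pow_eq_pow_val] at h0
        rw [eq_sub_iff_add_eq, eq_comm, ← eq_inv_smul_iff₀ h0, smul_add, smul_smul, smul_smul] at h
        exact ⟨_, _, h⟩
  rcases m.eq_nat_or_neg with ⟨k, rfl | rfl⟩
  · simpa using key k (by simpa using hm)
  · rcases key k (by simpa using hm) with h | ⟨u, w, h⟩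
    · left
      simpa using h
    · right
      refine ⟨-u, u * (X ^ k).1.trace + w, ?_⟩
      rw [eq_trace_smul_sub_inv (X ^ k)] at h
      rw [_root_.zpow_neg, zpow_natCast]
      nth_rw 1 [h]
      module

/-- The trace of a matrix of determinant one with eigenvalue `a`. -/
theorem trace_of_eigenvector {X : SL(2, ℂ)} {v : Fin 2 → ℂ} (hv : v ≠ 0) {a : ℂ}
    (h : X.1.mulVec v = a • v) : ∃ u : ℂˣ, a = u ∧ X.1.trace = u + ↑u⁻¹ := by
  have h0 : (X.1 - a • (1 : Matrix (Fin 2) (Fin 2) ℂ)).det = 0 := by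
    refine Matrix.exists_mulVec_eq_zero_iff.1 ⟨v, hv, ?_⟩
    rw [Matrix.sub_mulVec, h, Matrix.smul_mulVec, Matrix.one_mulVec, sub_self]
  have hdet := X.2
  rw [Matrix.det_fin_two] at h0 hdet
  simp at h0
  have ha : a ≠ 0 := by
    rintro rfl
    simp [hdet] at h0
  refine ⟨Units.mk0 a ha, rfl, ?_⟩
  rw [Matrix.trace_fin_two, Units.val_inv_eq_inv_val, Units.val_mk0]
  field_simp
  linear_combination hdet - h0

/-- The stabilizer of a line. -/
def lineStabilizer (v : Fin 2 → ℂ) : Subgroup SL(2, ℂ) where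
  carrier := {g | ∃ c : ℂ, g.1.mulVec v = c • v}
  one_mem' := ⟨1, by simp⟩
  mul_mem' := by
    rintro g h ⟨c, hc⟩ ⟨d, hd⟩
    exact ⟨d * c, by simp [← Matrix.mulVec_mulVec, hc, hd, Matrix.mulVec_smul, smul_smul]⟩
  inv_mem' := by
    rintro g ⟨c, hc⟩
    have h : v = c • (g⁻¹).1.mulVec v := by
      rw [← Matrix.mulVec_smul, ← hc, Matrix.mulVec_mulVec, ← coe_mul, inv_mul_cancel, coe_one,
        Matrix.one_mulVec]
    rcases eq_or_ne c 0 with rfl | hc0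
    · rw [zero_smul] at h
      exact ⟨0, by simp [h]⟩
    · exact ⟨c⁻¹, by rw [eq_inv_smul_iff₀ hc0, ← h]⟩

/-- The other eigenvalue is 1 as well, so g - 1 and h - 1 are nilpotent with the same kernel if
nonzero, hence proportional. The identities `e1`, `e2`, `e3` are this proportionality; each is
checked after multiplication by both squared coordinates of v, one of which is nonzero. -/
theorem commute_of_fixed {v : Fin 2 → ℂ} (hv : v ≠ 0) {g h : SL(2, ℂ)} (hg : g.1.mulVec v = v)
    (hh : h.1.mulVec v = v) : g * h = h * g := by
  have key {g : SL(2, ℂ)} (hg : g.1.mulVec v = v) : g.1 0 0 * v 0 + g.1 0 1 * v 1 = v 0 ∧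
      g.1 1 0 * v 0 + g.1 1 1 * v 1 = v 1 ∧ g.1 1 1 = 2 - g.1 0 0 := by
    obtain ⟨u, hu, htr⟩ := trace_of_eigenvector hv (a := 1) (by rwa [one_smul])
    obtain rfl : u = 1 := Units.ext hu.symm
    rw [Matrix.trace_fin_two] at htr
    have h0 := congrFun hg 0
    have h1 := congrFun hg 1
    simp [Matrix.mulVec, dotProduct] at h0 h1 htr
    exact ⟨h0, h1, by linear_combination htr⟩
  obtain ⟨g0, g1, g2⟩ := key hg
  obtain ⟨h0, h1, h2⟩ := key hh
  have ha {x y : ℂ} (h : x * v 0 ^ 2 = y * v 0 ^ 2) (h' : x * v 1 ^ 2 = y * v 1 ^ 2) : x = y := by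
    by_contra hxy
    have hx {w : ℂ} (h : x * w ^ 2 = y * w ^ 2) : w = 0 := by
      have : (x - y) * w ^ 2 = 0 := by linear_combination h
      simpa [sub_eq_zero, hxy] using this
    refine hv (funext fun i => ?_)
    fin_cases i
    · exact hx h
    · exact hx h'
  rw [g2] at g1
  rw [h2] at h1
  have e1 : g.1 0 1 * h.1 1 0 = h.1 0 1 * g.1 1 0 := by
    refine ha ?_ ?_
    · linear_combination g.1 0 1 * v 0 * h1 - h.1 0 1 * v 0 * g1 + g.1 0 1 * v 1 * h0 -
        h.1 0 1 * v 1 * g0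
    · linear_combination h.1 1 0 * v 1 * g0 - g.1 1 0 * v 1 * h0 + h.1 1 0 * v 0 * g1 -
        g.1 1 0 * v 0 * h1
  have e2 : (g.1 0 0 - 1) * h.1 0 1 = (h.1 0 0 - 1) * g.1 0 1 := by
    refine ha ?_ ?_
    · linear_combination h.1 0 1 * v 0 * g0 - g.1 0 1 * v 0 * h0
    · linear_combination (g.1 0 0 - 1) * v 1 * h0 - (h.1 0 0 - 1) * v 1 * g0
  have e3 : (g.1 0 0 - 1) * h.1 1 0 = (h.1 0 0 - 1) * g.1 1 0 := by
    refine ha ?_ ?_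
    · linear_combination (g.1 0 0 - 1) * v 0 * h1 - (h.1 0 0 - 1) * v 0 * g1
    · linear_combination g.1 1 0 * v 1 * h1 - h.1 1 0 * v 1 * g1
  refine Subtype.ext ?_
  rw [coe_mul, coe_mul]
  ext i j
  fin_cases i <;> fin_cases j <;> simp [Matrix.mul_apply, g2, h2] 
  · linear_combination e1
  · linear_combination 2 * e2
  · linear_combination -2 * e3
  · linear_combination -e1

end Matrix.SpecialLinearGroup

/-! ### Representations of the torus groups -/

namespace TorusGroup

open Matrix Matrix.SpecialLinearGroup

variable {m n : ℤ}

/-- The representation with given images of the generators. -/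
def repOf (X Y : SL(2, ℂ)) (h : X ^ m = Y ^ n) : Rep m n :=
  PresentedGroup.toGroup (f := ![X, Y]) (by
    rintro _ rfl
    simp [h])

@[simp]
theorem repOf_gen_zero (X Y : SL(2, ℂ)) (h : X ^ m = Y ^ n) : repOf X Y h (gen m n 0) = X := by
  simp [repOf, gen]

@[simp]
theorem repOf_gen_one (X Y : SL(2, ℂ)) (h : X ^ m = Y ^ n) : repOf X Y h (gen m n 1) = Y := by
  simp [repOf, gen]

theorem rep_relation (ρ : Rep m n) : ρ (gen m n 0) ^ m = ρ (gen m n 1) ^ n := by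
  have h := PresentedGroup.mk_eq_mk_of_mul_inv_mem (Set.mem_singleton
    (FreeGroup.of (0 : Fin 2) ^ m * (FreeGroup.of 1 ^ n)⁻¹))
  rw [map_zpow, map_zpow] at h
  rw [← map_zpow, ← map_zpow]
  exact congrArg ρ h

theorem rep_ext {ρ σ : Rep m n} (h0 : ρ (gen m n 0) = σ (gen m n 0))
    (h1 : ρ (gen m n 1) = σ (gen m n 1)) : ρ = σ := by
  refine PresentedGroup.ext fun k => ?_
  fin_cases k
  · exact h0
  · exact h1

theorem mem_subgroup_of_gen {ρ : Rep m n} {H : Subgroup SL(2, ℂ)} (h0 : ρ (gen m n 0) ∈ H)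
    (h1 : ρ (gen m n 1) ∈ H) (g : TorusGroup m n) : ρ g ∈ H := by
  refine PresentedGroup.generated_by _ (H.comap ρ) (fun k => ?_) g
  fin_cases k
  · exact h0
  · exact h1

theorem isReducible_iff {ρ : Rep m n} : IsReducible ρ ↔ ∃ v : Fin 2 → ℂ, v ≠ 0 ∧
    (∃ a : ℂ, (ρ (gen m n 0)).1.mulVec v = a • v) ∧
    ∃ c : ℂ, (ρ (gen m n 1)).1.mulVec v = c • v := by
  constructor
  · rintro ⟨v, hv, h⟩
    exact ⟨v, hv, h _, h _⟩
  · rintro ⟨v, hv, h0, h1⟩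
    exact ⟨v, hv, mem_subgroup_of_gen (H := lineStabilizer v) h0 h1⟩

theorem hasAbelianImage_iff {ρ : Rep m n} : HasAbelianImage ρ ↔
    ρ (gen m n 0) * ρ (gen m n 1) = ρ (gen m n 1) * ρ (gen m n 0) := by
  refine ⟨fun h => h _ _, fun h => ?_⟩
  have key (k : SL(2, ℂ)) (h0 : k * ρ (gen m n 0) = ρ (gen m n 0) * k)
      (h1 : k * ρ (gen m n 1) = ρ (gen m n 1) * k) (g : TorusGroup m n) : k * ρ g = ρ g * k :=
    (Subgroup.mem_centralizer_singleton_iff.1 (mem_subgroup_of_gen (H := Subgroup.centralizer {k})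
      (Subgroup.mem_centralizer_singleton_iff.2 h0.symm)
      (Subgroup.mem_centralizer_singleton_iff.2 h1.symm) g)).symm
  exact fun g g' => (key _ (key _ rfl h g).symm (key _ h.symm rfl g).symm g')

/-- The image of a reducible representation is metabelian. -/
theorem derivedSeries_range_of_isReducible {ρ : Rep m n} (h : IsReducible ρ) :
    derivedSeries ρ.range 2 = ⊥ := by
  obtain ⟨v, hv, h⟩ := h
  -- The image acts on v by scalars, which commute, so its commutators fix v; the stabilizer of v is
  -- abelian by `commute_of_fixed`.
  have hfix : ∀ x : ρ.range, x ∈ commutator ρ.range → x.1.1.mulVec v = v := by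
    let F : Subgroup ρ.range :=
      { carrier := {x | x.1.1.mulVec v = v}
        one_mem' := Matrix.one_mulVec v
        mul_mem' := by
          intro x y hx hy
          have hx : x.1.1.mulVec v = v := hx
          have hy : y.1.1.mulVec v = v := hy
          change (x.1 * y.1).1.mulVec v = v
          rw [coe_mul, ← Matrix.mulVec_mulVec, hy, hx]
        inv_mem' := by
          intro x hx
          have hx : x.1.1.mulVec v = v := hx
          change (x.1⁻¹).1.mulVec v = v
          nth_rw 1 [← hx]
          rw [Matrix.mulVec_mulVec, ← coe_mul, inv_mul_cancel, coe_one, Matrix.one_mulVec] }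
    have hF : commutator ρ.range ≤ F := by
      rw [commutator_def, Subgroup.commutator_le]
      rintro ⟨_, x, rfl⟩ - ⟨_, y, rfl⟩ -
      change (ρ x * ρ y * (ρ x)⁻¹ * (ρ y)⁻¹).1.mulVec v = v
      obtain ⟨a, ha⟩ := h x
      obtain ⟨b, hb⟩ := h y
      have h1 : (ρ x * ρ y).1.mulVec v = (ρ y * ρ x).1.mulVec v := by
        rw [coe_mul, coe_mul, ← Matrix.mulVec_mulVec, ← Matrix.mulVec_mulVec, ha, hb,
          Matrix.mulVec_smul, Matrix.mulVec_smul, ha, hb, smul_comm]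
      obtain ⟨e, he⟩ := h (y * x)⁻¹
      rw [map_inv, map_mul] at he
      rw [mul_assoc, ← _root_.mul_inv_rev, coe_mul, ← Matrix.mulVec_mulVec, he, Matrix.mulVec_smul, h1,
        ← Matrix.mulVec_smul, ← he, Matrix.mulVec_mulVec, ← coe_mul, mul_inv_cancel, coe_one,
        Matrix.one_mulVec]
    exact hF
  rw [derivedSeries_succ, derivedSeries_one, Subgroup.commutator_eq_bot_iff_le_centralizer]
  intro x hx y hy
  exact Subtype.ext (commute_of_fixed hv (hfix y hy) (hfix x hx))

theorem mem_redMetabelian_iff {ρ : Rep m n} :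
    ρ ∈ redMetabelian m n ↔ IsReducible ρ ∧ ¬ HasAbelianImage ρ :=
  ⟨fun h => ⟨h.1, h.2.2⟩, fun h => ⟨h.1, derivedSeries_range_of_isReducible h.1, h.2⟩⟩

/-! ### The components -/

/-- The pairs of the eigenvalues of the images of the generators, on a common eigenvector, of the
nonabelian reducible representations. -/
def eigenPairs (m n : ℤ) : Set (ℂˣ × ℂˣ) :=
  {p | p.1 ^ 2 ≠ 1 ∧ p.2 ^ 2 ≠ 1 ∧ p.1 ^ m = p.2 ^ n ∧ (p.1 ^ m) ^ 2 = 1}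

/-- The representations whose images of the generators have a common eigenvector with the
eigenvalues `p.1` and `p.2`. -/
def redComponent (m n : ℤ) (p : ℂˣ × ℂˣ) : Set (Rep m n) :=
  {ρ | (ρ (gen m n 0)).1.trace = p.1 + ↑p.1⁻¹ ∧ (ρ (gen m n 1)).1.trace = p.2 + ↑p.2⁻¹ ∧
    ((ρ (gen m n 1)).1 - (p.2 : ℂ) • (1 : Matrix (Fin 2) (Fin 2) ℂ)) *
      ((ρ (gen m n 0)).1 - (↑p.1⁻¹ : ℂ) • (1 : Matrix (Fin 2) (Fin 2) ℂ)) = 0}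

/-- Both powers are the same scalar ±1. The group relation therefore imposes nothing beyond the two
traces. -/
theorem zpow_eq_zpow_of_mem {p : ℂˣ × ℂˣ} (hp : p ∈ eigenPairs m n) {X Y : SL(2, ℂ)}
    (hX : X.1.trace = p.1 + ↑p.1⁻¹) (hY : Y.1.trace = p.2 + ↑p.2⁻¹) : X ^ m = Y ^ n := by
  refine Subtype.ext ?_
  rw [zpow_eq_scalar hX hp.1 hp.2.2.2, zpow_eq_scalar hY hp.2.1 (by rw [← hp.2.2.1, hp.2.2.2]),
    hp.2.2.1]

theorem sub_mul_sub_inv_eq_zero {X : Matrix (Fin 2) (Fin 2) ℂ} {a : ℂˣ} (hdet : X.det = 1)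
    (htr : X.trace = a + ↑a⁻¹) : (X - (a : ℂ) • (1 : Matrix (Fin 2) (Fin 2) ℂ)) *
      (X - (↑a⁻¹ : ℂ) • (1 : Matrix (Fin 2) (Fin 2) ℂ)) = 0 := by
  have h := mul_self_eq_trace_smul_sub_one hdet
  rw [htr] at h
  have h1 : (X - (a : ℂ) • (1 : Matrix (Fin 2) (Fin 2) ℂ)) *
      (X - (↑a⁻¹ : ℂ) • (1 : Matrix (Fin 2) (Fin 2) ℂ)) =
        ((a : ℂ) * ↑a⁻¹ - 1) • (1 : Matrix (Fin 2) (Fin 2) ℂ) := by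
    simp only [sub_mul, mul_sub, h, smul_mul_assoc, mul_smul_comm, one_mul, mul_one]
    module
  rw [h1, a.mul_inv, sub_self, zero_smul]

theorem sub_smul_one_ne_zero {X : Matrix (Fin 2) (Fin 2) ℂ} {a : ℂˣ} (ha : a ^ 2 ≠ 1)
    (htr : X.trace = a + ↑a⁻¹) : X - (a : ℂ) • (1 : Matrix (Fin 2) (Fin 2) ℂ) ≠ 0 := by
  intro h0
  rw [sub_eq_zero.1 h0, Matrix.trace_fin_two] at htr
  simp at htr
  refine val_sub_inv_ne_zero ha ?_
  rw [Units.val_inv_eq_inv_val]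
  linear_combination htr

/-- Two vectors in the kernel of a nonzero matrix of size two are proportional. -/
theorem exists_smul_of_mulVec_eq_zero {M : Matrix (Fin 2) (Fin 2) ℂ} (hM : M ≠ 0)
    {v w : Fin 2 → ℂ} (hv : v ≠ 0) (hMv : M.mulVec v = 0) (hMw : M.mulVec w = 0) :
    ∃ t : ℂ, w = t • v := by
  have hD : v 0 * w 1 - v 1 * w 0 = 0 := by
    by_contra hD
    refine hM (Matrix.ext fun i j => mul_right_cancel₀ hD ?_)
    have h1 := congrFun hMv i
    have h2 := congrFun hMw i
    simp [Matrix.mulVec, dotProduct] at h1 h2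
    fin_cases j
    · simp only [Fin.zero_eta, Matrix.zero_apply, zero_mul]
      linear_combination w 1 * h1 - v 1 * h2
    · simp only [Fin.mk_one, Matrix.zero_apply, zero_mul]
      linear_combination v 0 * h2 - w 0 * h1
  by_cases h0 : v 0 = 0
  · have h1 : v 1 ≠ 0 := fun h1 => hv (funext fun i => by fin_cases i <;> simp [h0, h1])
    refine ⟨w 1 / v 1, funext fun i => ?_⟩
    fin_cases i <;> simp <;> field_simp
    linear_combination -hD
  · refine ⟨w 0 / v 0, funext fun i => ?_⟩
    fin_cases i <;> simp <;> field_simp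
    linear_combination hD

/-- A nonzero column of X - a⁻¹ is an eigenvector of X by Cayley–Hamilton and of Y by the equation
of the component. Such a column exists because a ≠ a⁻¹. -/
theorem isReducible_of_mem_redComponent {p : ℂˣ × ℂˣ} (hp : p.1 ^ 2 ≠ 1) {ρ : Rep m n}
    (hρ : ρ ∈ redComponent m n p) : IsReducible ρ := by
  obtain ⟨hX, hY, hXY⟩ := hρ
  set X := ρ (gen m n 0)
  set Y := ρ (gen m n 1)
  have hCH := sub_mul_sub_inv_eq_zero X.2 hX
  have hne : X.1 - (↑p.1⁻¹ : ℂ) • (1 : Matrix (Fin 2) (Fin 2) ℂ) ≠ 0 := by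
    refine sub_smul_one_ne_zero (by rwa [inv_pow, ne_eq, inv_eq_one]) ?_
    rw [hX, inv_inv, add_comm]
  obtain ⟨j, hj⟩ : ∃ j, (X.1 - (↑p.1⁻¹ : ℂ) • (1 : Matrix (Fin 2) (Fin 2) ℂ)).col j ≠ 0 := by
    by_contra! hc
    exact hne (Matrix.ext fun i j => congrFun (hc j) i)
  have key {Z : Matrix (Fin 2) (Fin 2) ℂ} {z : ℂ}
      (h : (Z - z • (1 : Matrix (Fin 2) (Fin 2) ℂ)) *
        (X.1 - (↑p.1⁻¹ : ℂ) • (1 : Matrix (Fin 2) (Fin 2) ℂ)) = 0) :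
      Z.mulVec ((X.1 - (↑p.1⁻¹ : ℂ) • (1 : Matrix (Fin 2) (Fin 2) ℂ)).col j) =
        z • (X.1 - (↑p.1⁻¹ : ℂ) • (1 : Matrix (Fin 2) (Fin 2) ℂ)).col j := by
    have h1 := congrArg (fun M => M.col j) h
    have h2 : (Z - z • (1 : Matrix (Fin 2) (Fin 2) ℂ)).mulVec
        ((X.1 - (↑p.1⁻¹ : ℂ) • (1 : Matrix (Fin 2) (Fin 2) ℂ)).col j) = 0 := h1
    rwa [Matrix.sub_mulVec, Matrix.smul_mulVec, Matrix.one_mulVec, sub_eq_zero] at h2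
  exact isReducible_iff.2 ⟨_, hj, ⟨_, key hCH⟩, ⟨_, key hXY⟩⟩

theorem zpow_mulVec {X : SL(2, ℂ)} {v : Fin 2 → ℂ} {a : ℂˣ} (h : X.1.mulVec v = (a : ℂ) • v)
    (m : ℤ) : (X ^ m).1.mulVec v = ((a ^ m : ℂˣ) : ℂ) • v := by
  have hpow (k : ℕ) : (X ^ k).1.mulVec v = ((a ^ k : ℂˣ) : ℂ) • v := by
    induction k with
    | zero => simp
    | succ k ih =>
      rw [pow_succ, coe_mul, ← Matrix.mulVec_mulVec, h, Matrix.mulVec_smul, ih, smul_smul,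
        ← Units.val_mul, pow_succ']
  rcases m.eq_nat_or_neg with ⟨k, rfl | rfl⟩
  · rw [zpow_natCast, zpow_natCast, hpow]
  · have h1 : v = ((a ^ k : ℂˣ) : ℂ) • ((X ^ k)⁻¹).1.mulVec v := by
      rw [← Matrix.mulVec_smul, ← hpow, Matrix.mulVec_mulVec, ← coe_mul, inv_mul_cancel, coe_one,
        Matrix.one_mulVec]
    rw [_root_.zpow_neg, _root_.zpow_neg, zpow_natCast, zpow_natCast, Units.val_inv_eq_inv_val,
      eq_inv_smul_iff₀ (Units.ne_zero _), ← h1]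

/-- If X or Y is a linear combination of X^m = Y^n and the identity, then X and Y commute. Of the
four combinations of `eigenvalue_cases` only the one without such an expression survives. -/
theorem exists_eigenPair (hm : m ≠ 0) (hn : n ≠ 0) {ρ : Rep m n} (h : ρ ∈ redMetabelian m n) :
    ∃ p ∈ eigenPairs m n, ρ ∈ redComponent m n p := by
  rw [mem_redMetabelian_iff, isReducible_iff, hasAbelianImage_iff] at h
  obtain ⟨⟨v, hv, ⟨a, ha⟩, ⟨c, hc⟩⟩, hab⟩ := h
  have hrel := rep_relation ρ
  set X := ρ (gen m n 0) with hXdef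
  set Y := ρ (gen m n 1) with hYdef
  obtain ⟨a, rfl, hX⟩ := trace_of_eigenvector hv ha
  obtain ⟨c, rfl, hY⟩ := trace_of_eigenvector hv hc
  have hac : a ^ m = c ^ n := by
    refine Units.ext (smul_left_injective ℂ hv ?_)
    beta_reduce
    rw [← zpow_mulVec ha, ← zpow_mulVec hc, hrel]
  have hab' : ¬ X.1 * Y.1 = Y.1 * X.1 := fun h => hab (Subtype.ext h)
  have hcomm {M N : Matrix (Fin 2) (Fin 2) ℂ} {u w : ℂ} (h : M = u • (1 : Matrix (Fin 2) (Fin 2) ℂ)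
      + w • (1 : Matrix (Fin 2) (Fin 2) ℂ)) : M * N = N * M := by
    simp [h, add_mul, mul_add]
  obtain ⟨ha2, ham⟩ | ⟨u, w, hu⟩ := eigenvalue_cases hX hm
  · obtain ⟨hc2, hcn⟩ | ⟨u', w', hu'⟩ := eigenvalue_cases hY hn
    · refine ⟨(a, c), ⟨ha2, hc2, hac, ham⟩, hX, hY, ?_⟩
      have hzero {Z : Matrix (Fin 2) (Fin 2) ℂ} {z : ℂ} {w : Fin 2 → ℂ} :
          Z.mulVec w = z • w ↔
            (Z - z • (1 : Matrix (Fin 2) (Fin 2) ℂ)).mulVec w = 0 := by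
        rw [Matrix.sub_mulVec, Matrix.smul_mulVec, Matrix.one_mulVec, sub_eq_zero]
      -- The columns of X - a⁻¹ lie in the kernel of X - a, which is the line of v, and Y - c kills
      -- v.
      refine Matrix.ext_of_mulVec_single fun j => ?_
      rw [← Matrix.mulVec_mulVec]
      obtain ⟨t, ht⟩ := exists_smul_of_mulVec_eq_zero (sub_smul_one_ne_zero ha2 hX) hv
        (hzero.1 ha) (w := (X.1 - (↑a⁻¹ : ℂ) • (1 : Matrix (Fin 2) (Fin 2) ℂ)).mulVec
          (Pi.single j 1)) (by
        rw [Matrix.mulVec_mulVec, sub_mul_sub_inv_eq_zero X.2 hX, Matrix.zero_mulVec])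
      rw [ht, Matrix.mulVec_smul, hzero.1 hc, smul_zero, Matrix.zero_mulVec]
    · rw [← hrel, zpow_eq_scalar hX ha2 ham, smul_smul] at hu'
      exact absurd (hcomm hu').symm hab'
  · obtain ⟨hc2, hcn⟩ | ⟨u', w', hu'⟩ := eigenvalue_cases hY hn
    · rw [hrel, zpow_eq_scalar hY hc2 hcn, smul_smul] at hu
      exact absurd (hcomm hu) hab'
    · rw [← hrel] at hu'
      refine absurd ?_ hab'
      rw [hu, hu']
      simp only [add_mul, mul_add, smul_mul_assoc, mul_smul_comm, one_mul, mul_one]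
      module

end TorusGroup

/-! ### Counting roots of unity -/

theorem Units.sq_eq_one_iff_eq_or_neg {a : ℂˣ} : a ^ 2 = 1 ↔ a = 1 ∨ a = -1 := by
  rw [pow_two, ← Units.val_inj, Units.val_mul, Units.val_one, mul_self_eq_one_iff,
    ← Units.val_one, ← Units.val_neg, Units.val_inj, Units.val_inj]

theorem one_ne_neg_one_units : (1 : ℂˣ) ≠ -1 := fun h => by
  have := congrArg Units.val h
  norm_num at this

theorem finite_setOf_pow_eq_one {k : ℕ} (hk : k ≠ 0) : {a : ℂˣ | a ^ k = 1}.Finite := by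
  have : NeZero k := ⟨hk⟩
  exact Set.finite_coe_iff.1 (inferInstanceAs (Finite (rootsOfUnity k ℂ)))

theorem ncard_setOf_pow_eq_one {k : ℕ} (hk : k ≠ 0) : {a : ℂˣ | a ^ k = 1}.ncard = k := by
  have : NeZero k := ⟨hk⟩
  change (rootsOfUnity k ℂ : Set ℂˣ).ncard = k
  rw [← Nat.card_coe_set_eq]
  exact Complex.card_rootsOfUnity k

theorem setOf_pow_eq_neg_one (k : ℕ) :
    {a : ℂˣ | a ^ k = -1} = {a | a ^ (2 * k) = 1} \ {a | a ^ k = 1} := by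
  ext a
  simp only [Set.mem_ofPred_eq, Set.mem_sdiff, mul_comm 2 k, pow_mul,
    Units.sq_eq_one_iff_eq_or_neg]
  constructor
  · exact fun h => ⟨Or.inr h, fun h' => one_ne_neg_one_units (h'.symm.trans h)⟩
  · exact fun h => h.1.resolve_left h.2

theorem finite_setOf_pow_eq_neg_one {k : ℕ} (hk : k ≠ 0) : {a : ℂˣ | a ^ k = -1}.Finite := by
  rw [setOf_pow_eq_neg_one]
  exact (finite_setOf_pow_eq_one (by simpa using hk)).sdiff

theorem ncard_setOf_pow_eq_neg_one {k : ℕ} (hk : k ≠ 0) : {a : ℂˣ | a ^ k = -1}.ncard = k := by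
  have hsub : {a : ℂˣ | a ^ k = 1} ⊆ {a | a ^ (2 * k) = 1} := by
    intro a ha
    rw [Set.mem_ofPred_eq] at ha ⊢
    rw [mul_comm, pow_mul, ha, one_pow]
  rw [setOf_pow_eq_neg_one, Set.ncard_sdiff hsub (finite_setOf_pow_eq_one hk),
    ncard_setOf_pow_eq_one hk, ncard_setOf_pow_eq_one (by simpa using hk)]
  omega

/-- The `a ≠ ± 1` with `a ^ k = e`. -/
def properRoots (k : ℕ) (e : ℂˣ) : Set ℂˣ := {a | a ^ k = e} \ {1, -1}

/-- For even k both 1 and -1 are k-th roots of 1 and neither is one of -1; for odd k each is a root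
of itself only. The counts are stated in ℤ to avoid truncated subtraction. -/
theorem ncard_properRoots_one_of_even {k : ℕ} (hk : k ≠ 0) (he : Even k) :
    ((properRoots k 1).ncard : ℤ) = k - 2 := by
  have hsub : {1, -1} ⊆ {a : ℂˣ | a ^ k = 1} := by
    rintro a (rfl | rfl)
    · simp
    · simp [he.neg_one_pow]
  have h := Set.ncard_sdiff_add_ncard_of_subset hsub (finite_setOf_pow_eq_one hk)
  rw [Set.ncard_pair one_ne_neg_one_units, ncard_setOf_pow_eq_one hk] at h
  rw [properRoots]
  omega

theorem ncard_properRoots_one_of_odd {k : ℕ} (ho : Odd k) :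
    ((properRoots k 1).ncard : ℤ) = k - 1 := by
  have hk : k ≠ 0 := ho.pos.ne'
  have heq : properRoots k 1 = {a : ℂˣ | a ^ k = 1} \ {1} := by
    ext a
    simp only [properRoots, Set.mem_sdiff, Set.mem_ofPred_eq, Set.mem_insert_iff,
      Set.mem_singleton_iff, not_or]
    refine ⟨fun h => ⟨h.1, h.2.1⟩, fun h => ⟨h.1, h.2, ?_⟩⟩
    rintro rfl
    rw [ho.neg_one_pow] at h
    exact one_ne_neg_one_units h.1.symm
  have h := Set.ncard_sdiff_add_ncard_of_subset (s := {(1 : ℂˣ)}) (t := {a : ℂˣ | a ^ k = 1})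
    (by simp) (finite_setOf_pow_eq_one hk)
  rw [Set.ncard_singleton, ncard_setOf_pow_eq_one hk, ← heq] at h
  omega

theorem ncard_properRoots_neg_one_of_even {k : ℕ} (hk : k ≠ 0) (he : Even k) :
    ((properRoots k (-1)).ncard : ℤ) = k := by
  have heq : properRoots k (-1) = {a : ℂˣ | a ^ k = -1} := by
    refine sdiff_eq_left.2 (Set.disjoint_left.2 ?_)
    rintro a ha (rfl | rfl)
    · simp at ha
    · rw [Set.mem_ofPred_eq, he.neg_one_pow] at ha
      exact one_ne_neg_one_units ha
  rw [heq, ncard_setOf_pow_eq_neg_one hk]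

theorem ncard_properRoots_neg_one_of_odd {k : ℕ} (ho : Odd k) :
    ((properRoots k (-1)).ncard : ℤ) = k - 1 := by
  have hk : k ≠ 0 := ho.pos.ne'
  have heq : properRoots k (-1) = {a : ℂˣ | a ^ k = -1} \ {-1} := by
    ext a
    simp only [properRoots, Set.mem_sdiff, Set.mem_ofPred_eq, Set.mem_insert_iff,
      Set.mem_singleton_iff, not_or]
    refine ⟨fun h => ⟨h.1, h.2.2⟩, fun h => ⟨h.1, ?_, h.2⟩⟩
    rintro rfl
    rw [one_pow] at h
    exact one_ne_neg_one_units h.1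
  have h := Set.ncard_sdiff_add_ncard_of_subset (s := {(-1 : ℂˣ)}) (t := {a : ℂˣ | a ^ k = -1})
    (by simp [ho.neg_one_pow]) (finite_setOf_pow_eq_neg_one hk)
  rw [Set.ncard_singleton, ncard_setOf_pow_eq_neg_one hk, ← heq] at h
  omega

namespace TorusGroup

variable {m n : ℤ}

/-- Splits by the common value ±1 of a^m and c^n. -/
theorem eigenPairs_eq (m n : ℤ) : eigenPairs m n =
    (properRoots m.natAbs 1 ×ˢ properRoots n.natAbs 1) ∪
      (properRoots m.natAbs (-1) ×ˢ properRoots n.natAbs (-1)) := by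
  have hneg : (-1 : ℂˣ)⁻¹ = -1 := by simp
  ext p
  simp only [eigenPairs, properRoots, Set.mem_union, Set.mem_prod, Set.mem_sdiff,
    Set.mem_ofPred_eq, Set.mem_insert_iff, Set.mem_singleton_iff, ne_eq,
    Units.sq_eq_one_iff_eq_or_neg, Matrix.SpecialLinearGroup.pow_natAbs_eq_iff inv_one,
    Matrix.SpecialLinearGroup.pow_natAbs_eq_iff hneg]
  constructor
  · rintro ⟨h1, h2, h3, h4 | h4⟩
    · exact Or.inl ⟨⟨h4, h1⟩, h3 ▸ h4, h2⟩
    · exact Or.inr ⟨⟨h4, h1⟩, h3 ▸ h4, h2⟩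
  · rintro (⟨⟨h4, h1⟩, h3, h2⟩ | ⟨⟨h4, h1⟩, h3, h2⟩)
    · exact ⟨h1, h2, h4.trans h3.symm, Or.inl h4⟩
    · exact ⟨h1, h2, h4.trans h3.symm, Or.inr h4⟩

theorem finite_properRoots_prod (hm : m ≠ 0) (hn : n ≠ 0) :
    (properRoots m.natAbs 1 ×ˢ properRoots n.natAbs 1).Finite ∧
      (properRoots m.natAbs (-1) ×ˢ properRoots n.natAbs (-1)).Finite :=
  ⟨(finite_setOf_pow_eq_one (Int.natAbs_ne_zero.2 hm)).sdiff.prod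
    (finite_setOf_pow_eq_one (Int.natAbs_ne_zero.2 hn)).sdiff,
    (finite_setOf_pow_eq_neg_one (Int.natAbs_ne_zero.2 hm)).sdiff.prod
    (finite_setOf_pow_eq_neg_one (Int.natAbs_ne_zero.2 hn)).sdiff⟩

theorem finite_eigenPairs (hm : m ≠ 0) (hn : n ≠ 0) : (eigenPairs m n).Finite := by
  rw [eigenPairs_eq]
  exact (finite_properRoots_prod hm hn).1.union (finite_properRoots_prod hm hn).2

theorem ncard_eigenPairs (hm : m ≠ 0) (hn : n ≠ 0) : (eigenPairs m n).ncard =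
    (properRoots m.natAbs 1).ncard * (properRoots n.natAbs 1).ncard +
      (properRoots m.natAbs (-1)).ncard * (properRoots n.natAbs (-1)).ncard := by
  rw [eigenPairs_eq, Set.ncard_union_eq _ (finite_properRoots_prod hm hn).1
    (finite_properRoots_prod hm hn).2, Set.ncard_prod, Set.ncard_prod]
  rw [Set.disjoint_left]
  rintro p ⟨h, -⟩ ⟨h', -⟩
  exact one_ne_neg_one_units (h.1.symm.trans h'.1)

theorem ncard_eigenPairs_of_odd (hm : m ≠ 0) (hn : n ≠ 0) (h : Odd (Int.gcd m n)) :
    ((eigenPairs m n).ncard : ℤ) = 2 * (|m| - 1) * (|n| - 1) := by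
  have hm' := Int.natAbs_ne_zero.2 hm
  have hn' := Int.natAbs_ne_zero.2 hn
  rw [ncard_eigenPairs hm hn, Int.abs_eq_natAbs, Int.abs_eq_natAbs, Nat.cast_add,
    Nat.cast_mul, Nat.cast_mul]
  rcases Nat.even_or_odd m.natAbs with h1 | h1 <;> rcases Nat.even_or_odd n.natAbs with h2 | h2
  · refine absurd h (Nat.not_odd_iff_even.2 (even_iff_two_dvd.2 ?_))
    exact Nat.dvd_gcd (even_iff_two_dvd.1 h1) (even_iff_two_dvd.1 h2)
  · rw [ncard_properRoots_one_of_even hm' h1, ncard_properRoots_neg_one_of_even hm' h1,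
      ncard_properRoots_one_of_odd h2, ncard_properRoots_neg_one_of_odd h2]
    ring
  · rw [ncard_properRoots_one_of_even hn' h2, ncard_properRoots_neg_one_of_even hn' h2,
      ncard_properRoots_one_of_odd h1, ncard_properRoots_neg_one_of_odd h1]
    ring
  · rw [ncard_properRoots_one_of_odd h2, ncard_properRoots_neg_one_of_odd h2,
      ncard_properRoots_one_of_odd h1, ncard_properRoots_neg_one_of_odd h1]
    ring

theorem ncard_eigenPairs_of_even (hm : m ≠ 0) (hn : n ≠ 0) (h : Even (Int.gcd m n)) :
    ((eigenPairs m n).ncard : ℤ) = 2 * ((|m| - 1) * (|n| - 1) + 1) := by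
  have hm' := Int.natAbs_ne_zero.2 hm
  have hn' := Int.natAbs_ne_zero.2 hn
  have h1 : Even m.natAbs :=
    even_iff_two_dvd.2 ((even_iff_two_dvd.1 h).trans (Nat.gcd_dvd_left _ _))
  have h2 : Even n.natAbs :=
    even_iff_two_dvd.2 ((even_iff_two_dvd.1 h).trans (Nat.gcd_dvd_right _ _))
  rw [ncard_eigenPairs hm hn, Int.abs_eq_natAbs, Int.abs_eq_natAbs, Nat.cast_add,
    Nat.cast_mul, Nat.cast_mul]
  rw [ncard_properRoots_one_of_even hm' h1, ncard_properRoots_neg_one_of_even hm' h1,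
    ncard_properRoots_one_of_even hn' h2, ncard_properRoots_neg_one_of_even hn' h2]
  ring

end TorusGroup

namespace TorusGroup

open Matrix Matrix.SpecialLinearGroup

attribute [local instance] zariskiTopology

variable {m n : ℤ}

/-! ### The topology of the representation variety -/

theorem continuous_coords : Continuous (coords : Rep m n → (Fin 2 × Fin 2 × Fin 2 → ℂ)) :=
  continuous_induced_dom

theorem isClosed_eq_zero {f : (Fin 2 × Fin 2 × Fin 2 → ℂ) → ℂ} (hf : IsPolynomialFun f) :
    IsClosed {ρ : Rep m n | f (coords ρ) = 0} :=
  (zariskiTopology.isClosed_eq_zero hf).preimage continuous_coords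

theorem isOpen_ne_zero {f : (Fin 2 × Fin 2 × Fin 2 → ℂ) → ℂ} (hf : IsPolynomialFun f) :
    IsOpen {ρ : Rep m n | f (coords ρ) ≠ 0} :=
  (isClosed_eq_zero hf).isOpen_compl

theorem continuous_of_polynomial {σ : Type} {F : (σ → ℂ) → Rep m n}
    (h : ∀ k i j, IsPolynomialFun fun x => (F x (gen m n k)).1 i j) : Continuous F :=
  continuous_induced_rng.2 (zariskiTopology.continuous_of_polynomial fun k => h k.1 k.2.1 k.2.2)

/-- Conjugation of representations. -/
def conjRep (g : SL(2, ℂ)) (ρ : Rep m n) : Rep m n := (MulAut.conj g).toMonoidHom.comp ρ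

theorem conjRep_apply (g : SL(2, ℂ)) (ρ : Rep m n) (x : TorusGroup m n) :
    conjRep g ρ x = g * ρ x * g⁻¹ := rfl

theorem conjRep_inv_conjRep (g : SL(2, ℂ)) (ρ : Rep m n) : conjRep g⁻¹ (conjRep g ρ) = ρ := by
  ext1 x
  simp only [conjRep_apply]
  group

theorem val_conj (g X : SL(2, ℂ)) : (g * X * g⁻¹).1 = g.1 * X.1 * g.1.adjugate := rfl

theorem continuous_conjRep (g : SL(2, ℂ)) : Continuous (conjRep g : Rep m n → Rep m n) := by
  refine continuous_induced_rng.2 ?_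
  have h : Continuous fun (x : Fin 2 × Fin 2 × Fin 2 → ℂ) (k : Fin 2 × Fin 2 × Fin 2) =>
      (g.1 * (Matrix.of fun i j => x (k.1, i, j)) * g.1.adjugate) k.2.1 k.2.2 := by
    refine zariskiTopology.continuous_of_polynomial fun k => ?_
    simp only [Matrix.mul_apply, Fin.sum_univ_two, Matrix.of_apply]
    fun_prop
  have h' : coords ∘ conjRep g = (fun (x : Fin 2 × Fin 2 × Fin 2 → ℂ) (k : Fin 2 × Fin 2 × Fin 2) =>
      (g.1 * (Matrix.of fun i j => x (k.1, i, j)) * g.1.adjugate) k.2.1 k.2.2) ∘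
        (coords : Rep m n → _) := by
    funext ρ k
    simp only [Function.comp_apply, coords, conjRep_apply, val_conj]
    rfl
  rw [h']
  exact h.comp continuous_coords

/-! ### The topology of the components -/

theorem conjRep_mem_redComponent {p : ℂˣ × ℂˣ} (g : SL(2, ℂ)) {ρ : Rep m n}
    (hρ : ρ ∈ redComponent m n p) : conjRep g ρ ∈ redComponent m n p := by
  have hg : g.1 * g.1.adjugate = 1 := by rw [Matrix.mul_adjugate, g.2, one_smul]
  have hg' : g.1.adjugate * g.1 = 1 := by rw [Matrix.adjugate_mul, g.2, one_smul]
  have htr (X : SL(2, ℂ)) : (g * X * g⁻¹).1.trace = X.1.trace := by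
    rw [val_conj, Matrix.trace_mul_cycle, hg', one_mul]
  have hsub (X : SL(2, ℂ)) (z : ℂ) : (g * X * g⁻¹).1 - z • (1 : Matrix (Fin 2) (Fin 2) ℂ) =
      g.1 * (X.1 - z • (1 : Matrix (Fin 2) (Fin 2) ℂ)) * g.1.adjugate := by
    rw [val_conj, mul_sub, sub_mul, mul_smul_comm, mul_one, smul_mul_assoc, hg]
  obtain ⟨h0, h1, h2⟩ := hρ
  refine ⟨by rw [conjRep_apply, htr, h0], by rw [conjRep_apply, htr, h1], ?_⟩
  rw [conjRep_apply, conjRep_apply, hsub, hsub]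
  rw [show ∀ A B C D E F : Matrix (Fin 2) (Fin 2) ℂ, A * B * C * (D * E * F) =
    A * (B * (C * D) * E) * F by intros; noncomm_ring, hg', mul_one, h2, mul_zero, zero_mul]

theorem isClosed_redComponent (p : ℂˣ × ℂˣ) : IsClosed (redComponent m n p) := by
  have h : redComponent m n p =
      {ρ | coords ρ (0, 0, 0) + coords ρ (0, 1, 1) - (p.1 + (↑p.1⁻¹ : ℂ)) = 0} ∩
      ({ρ | coords ρ (1, 0, 0) + coords ρ (1, 1, 1) - (p.2 + (↑p.2⁻¹ : ℂ)) = 0} ∩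
      ⋂ i, ⋂ j, {ρ | (((Matrix.of fun i j => coords ρ (1, i, j)) -
        (p.2 : ℂ) • (1 : Matrix (Fin 2) (Fin 2) ℂ)) * ((Matrix.of fun i j => coords ρ (0, i, j)) -
        (↑p.1⁻¹ : ℂ) • (1 : Matrix (Fin 2) (Fin 2) ℂ))) i j = 0}) := by
    ext ρ
    simp only [redComponent, Matrix.trace_fin_two, ← Matrix.ext_iff, Set.mem_inter_iff,
      Set.mem_iInter, Set.mem_ofPred_eq, sub_eq_zero (b := _ + _)]
    rfl
  rw [h]
  refine (isClosed_eq_zero (f := fun x => x (0, 0, 0) + x (0, 1, 1) - (p.1 + (↑p.1⁻¹ : ℂ)))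
    (by fun_prop)).inter ((isClosed_eq_zero
      (f := fun x => x (1, 0, 0) + x (1, 1, 1) - (p.2 + (↑p.2⁻¹ : ℂ))) (by fun_prop)).inter
    (isClosed_iInter fun i => isClosed_iInter fun j => ?_))
  refine isClosed_eq_zero (f := fun x => (((Matrix.of fun i j => x (1, i, j)) -
        (p.2 : ℂ) • (1 : Matrix (Fin 2) (Fin 2) ℂ)) * ((Matrix.of fun i j => x (0, i, j)) -
        (↑p.1⁻¹ : ℂ) • (1 : Matrix (Fin 2) (Fin 2) ℂ))) i j) ?_
  simp only [Matrix.mul_apply, Fin.sum_univ_two, Matrix.of_apply, Matrix.sub_apply]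
  fun_prop

/-- The matrix with the eigenvalue `a` on `(1, s)`, the determinant one and the upper right
entry `b`. -/
def triMatrix (a : ℂˣ) (s b : ℂ) : SL(2, ℂ) :=
  ⟨!![a - b * s, b; s * (a - ↑a⁻¹ - b * s), ↑a⁻¹ + b * s], by
    rw [Matrix.det_fin_two_of]
    linear_combination a.mul_inv⟩

theorem trace_triMatrix (a : ℂˣ) (s b : ℂ) : (triMatrix a s b).1.trace = a + ↑a⁻¹ := by
  simp only [triMatrix, Matrix.trace_fin_two_of]
  ring

variable {p : ℂˣ × ℂˣ}

/-- The representations in `redComponent m n p` that have the common eigenvector `(1, x 0)`. -/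
def chart (hp : p ∈ eigenPairs m n) (x : Fin 3 → ℂ) : Rep m n :=
  repOf (triMatrix p.1 (x 0) (x 1)) (triMatrix p.2 (x 0) (x 2))
    (zpow_eq_zpow_of_mem hp (trace_triMatrix _ _ _) (trace_triMatrix _ _ _))

theorem chart_gen_zero (hp : p ∈ eigenPairs m n) (x : Fin 3 → ℂ) :
    chart hp x (gen m n 0) = triMatrix p.1 (x 0) (x 1) := repOf_gen_zero _ _ _

theorem chart_gen_one (hp : p ∈ eigenPairs m n) (x : Fin 3 → ℂ) :
    chart hp x (gen m n 1) = triMatrix p.2 (x 0) (x 2) := repOf_gen_one _ _ _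

theorem chart_mem (hp : p ∈ eigenPairs m n) (x : Fin 3 → ℂ) :
    chart hp x ∈ redComponent m n p := by
  refine ⟨by rw [chart_gen_zero, trace_triMatrix], by rw [chart_gen_one, trace_triMatrix], ?_⟩
  rw [chart_gen_zero, chart_gen_one]
  ext i j
  fin_cases i <;> fin_cases j <;> simp [triMatrix, Matrix.mul_apply] <;> ring

theorem isPolynomialFun_triMatrix {σ : Type} (a : ℂˣ) {s b : (σ → ℂ) → ℂ}
    (hs : IsPolynomialFun s) (hb : IsPolynomialFun b) (i j : Fin 2) :
    IsPolynomialFun fun x => (triMatrix a (s x) (b x)).1 i j := by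
  fin_cases i <;> fin_cases j <;> simp [triMatrix] <;> fun_prop

theorem continuous_chart (hp : p ∈ eigenPairs m n) : Continuous (chart hp) := by
  refine continuous_of_polynomial fun k i j => ?_
  fin_cases k
  · simp only [Fin.zero_eta, chart_gen_zero]
    exact isPolynomialFun_triMatrix _ (by fun_prop) (by fun_prop) i j
  · simp only [Fin.mk_one, chart_gen_one]
    exact isPolynomialFun_triMatrix _ (by fun_prop) (by fun_prop) i j

/-- If X₀₁ ≠ 0, the a-eigenvector of X is (1, s) with s = (a - X₀₀) / X₀₁, and the equation of the
component makes it an eigenvector of Y. Only X₀₁ is inverted: Y₀₁ may vanish, so Y₁₀ comes from that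
equation and not from the determinant. -/
theorem eq_chart (hp : p ∈ eigenPairs m n) {ρ : Rep m n} (hρ : ρ ∈ redComponent m n p)
    (h0 : (ρ (gen m n 0)).1 0 1 ≠ 0) :
    ρ = chart hp ![((p.1 : ℂ) - (ρ (gen m n 0)).1 0 0) / (ρ (gen m n 0)).1 0 1,
      (ρ (gen m n 0)).1 0 1, (ρ (gen m n 1)).1 0 1] := by
  obtain ⟨hX, hY, hXY⟩ := hρ
  have hdet := (ρ (gen m n 0)).2
  have h1 := congrFun (congrFun hXY 0) 1
  have h2 := congrFun (congrFun hXY 1) 1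
  rw [Matrix.trace_fin_two] at hX hY
  rw [Matrix.det_fin_two] at hdet
  simp [Matrix.mul_apply] at h1 h2 hX hY
  set X := ρ (gen m n 0)
  set Y := ρ (gen m n 1)
  obtain ⟨s, hs⟩ : ∃ s, s = ((p.1 : ℂ) - X.1 0 0) / X.1 0 1 := ⟨_, rfl⟩
  rw [← hs]
  rw [eq_div_iff h0] at hs
  have ha := p.1.mul_inv
  rw [Units.val_inv_eq_inv_val] at ha
  have e00 : X.1 0 0 = p.1 - X.1 0 1 * s := by linear_combination hs
  have e11 : X.1 1 1 = (p.1 : ℂ)⁻¹ + X.1 0 1 * s := by linear_combination hX - hs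
  have f00 : Y.1 0 0 = p.2 - Y.1 0 1 * s := by
    refine mul_right_cancel₀ h0 ?_
    rw [e11] at h1
    linear_combination h1
  have f11 : Y.1 1 1 = (p.2 : ℂ)⁻¹ + Y.1 0 1 * s := by linear_combination hY - f00
  have e10 : X.1 1 0 = s * (p.1 - (p.1 : ℂ)⁻¹ - X.1 0 1 * s) := by
    refine mul_left_cancel₀ h0 ?_
    rw [e00, e11] at hdet
    linear_combination -hdet + ha
  have f10 : Y.1 1 0 = s * (p.2 - (p.2 : ℂ)⁻¹ - Y.1 0 1 * s) := by
    refine mul_right_cancel₀ h0 ?_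
    rw [e11, f11] at h2
    linear_combination h2
  refine rep_ext ?_ ?_
  · rw [chart_gen_zero]
    refine Subtype.ext (Matrix.ext fun i j => ?_)
    fin_cases i <;> fin_cases j <;> simp [triMatrix]
    · exact e00
    · rfl
    · exact e10
    · exact e11
  · rw [chart_gen_one]
    refine Subtype.ext (Matrix.ext fun i j => ?_)
    fin_cases i <;> fin_cases j <;> simp [triMatrix]
    · exact f00
    · rfl
    · exact f10
    · exact f11

/-- The discriminant (a - a⁻¹)² equals (X₁₁ - X₀₀)² + 4 X₀₁ X₁₀. -/
theorem not_scalar {X : SL(2, ℂ)} {a : ℂˣ} (ha : a ^ 2 ≠ 1) (htr : X.1.trace = a + ↑a⁻¹)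
    (h01 : X.1 0 1 = 0) : X.1 1 1 - X.1 0 0 ≠ 0 := by
  intro h
  have hdet := X.2
  have hinv := a.mul_inv
  rw [Matrix.det_fin_two] at hdet
  rw [Matrix.trace_fin_two] at htr
  have h2 : ((a : ℂ) - ↑a⁻¹) ^ 2 = 0 := by
    linear_combination -4 * hinv - (a + ↑a⁻¹ + X.1 0 0 + X.1 1 1) * htr + 4 * hdet +
      (X.1 1 1 - X.1 0 0) * h + 4 * X.1 1 0 * h01
  exact val_sub_inv_ne_zero ha (pow_eq_zero_iff two_ne_zero |>.1 h2)

/-- The upper unitriangular matrices. -/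
def upper (u : ℂ) : SL(2, ℂ) := ⟨!![1, u; 0, 1], by simp⟩

theorem conj_upper (u : ℂ) (X : SL(2, ℂ)) : (upper u * X * (upper u)⁻¹).1 =
    !![X.1 0 0 + u * X.1 1 0, X.1 0 1 + u * (X.1 1 1 - X.1 0 0) - u ^ 2 * X.1 1 0;
      X.1 1 0, X.1 1 1 - u * X.1 1 0] := by
  rw [val_conj, Matrix.adjugate_fin_two]
  ext i j
  fin_cases i <;> fin_cases j <;> simp [upper, Matrix.mul_apply, Matrix.vecMul, dotProduct] <;> ring

/-- A matrix with distinct eigenvalues has a conjugate with nonzero upper right entry. -/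
theorem exists_conj_upper_ne_zero {X : SL(2, ℂ)} {a : ℂˣ} (ha : a ^ 2 ≠ 1)
    (htr : X.1.trace = a + ↑a⁻¹) : ∃ u : ℂ, (upper u * X * (upper u)⁻¹).1 0 1 ≠ 0 := by
  simp only [conj_upper, Matrix.of_apply, Matrix.cons_val', Matrix.cons_val_zero,
    Matrix.cons_val_one]
  by_contra! hc
  -- The entry is quadratic in u; its values at 0, 1 and -1 give the constant and the linear
  -- coefficient.
  have h0 := hc 0
  have h1 := hc 1
  have h2 := hc (-1)
  refine not_scalar ha htr ?_ ?_
  · linear_combination h0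
  · linear_combination (h1 - h2) / 2

/-- Conjugation by `upper u` moves ρ along a line inside the component. The chart reaches the points
with u in a nonempty open set, so u = 0, which is ρ itself, lies in the closure. -/
theorem redComponent_subset_closure_range_chart (hp : p ∈ eigenPairs m n) :
    redComponent m n p ⊆ closure (Set.range (chart hp)) := by
  intro ρ hρ
  have hentry (k : Fin 2) (i j : Fin 2) :
      IsPolynomialFun fun x : Unit → ℂ => (conjRep (upper (x ())) ρ (gen m n k)).1 i j := by
    simp only [conjRep_apply, conj_upper]
    fin_cases i <;> fin_cases j <;> simp <;> fun_prop
  have hcont : Continuous fun x : Unit → ℂ => conjRep (upper (x ())) ρ :=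
    continuous_of_polynomial hentry
  obtain ⟨u, hu⟩ := exists_conj_upper_ne_zero hp.1 hρ.1
  have h := hcont.mem_closure_of_isOpen (zariskiTopology.isOpen_ne_zero (hentry 0 0 1))
    ⟨fun _ => u, hu⟩ (S := Set.range (chart hp))
    (fun x hx => ⟨_, (eq_chart hp (conjRep_mem_redComponent _ hρ) hx).symm⟩) 0
  have h0 : conjRep (upper ((0 : Unit → ℂ) ())) ρ = ρ := by
    have : upper ((0 : Unit → ℂ) ()) = 1 := Subtype.ext (by simp [upper, Matrix.one_fin_two])
    refine MonoidHom.ext fun x => ?_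
    rw [conjRep_apply, this]
    simp
  rwa [h0] at h

theorem closure_range_chart (hp : p ∈ eigenPairs m n) :
    closure (Set.range (chart hp)) = redComponent m n p :=
  ((isClosed_redComponent p).closure_subset_iff.2 (by rintro _ ⟨x, rfl⟩; exact chart_mem hp x)).antisymm
    (redComponent_subset_closure_range_chart hp)

theorem isIrreducible_redComponent (hp : p ∈ eigenPairs m n) :
    IsIrreducible (redComponent m n p) := by
  rw [← closure_range_chart hp, isIrreducible_iff_closure, ← Set.image_univ]
  exact (IrreducibleSpace.isIrreducible_univ _).image _ (continuous_chart hp).continuousOn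

/-- A polynomial condition that holds at some point of a component holds on a dense subset. -/
theorem redComponent_subset_closure_inter {S : Set (Rep m n)} (hS : IsOpen S)
    (h : (redComponent m n p ∩ S).Nonempty) (hp : p ∈ eigenPairs m n) :
    redComponent m n p ⊆ closure (redComponent m n p ∩ S) :=
  subset_closure_inter_of_isPreirreducible_of_isOpen (isIrreducible_redComponent hp).2 hS h

/-! ### The closure of the nonabelian reducible representations -/

theorem isOpen_not_hasAbelianImage : IsOpen {ρ : Rep m n | ¬ HasAbelianImage ρ} := by
  have h : {ρ : Rep m n | ¬ HasAbelianImage ρ} = ⋃ i, ⋃ j, {ρ | ((Matrix.of fun i j =>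
      coords ρ (0, i, j)) * (Matrix.of fun i j => coords ρ (1, i, j)) - (Matrix.of fun i j =>
      coords ρ (1, i, j)) * (Matrix.of fun i j => coords ρ (0, i, j))) i j ≠ 0} := by
    ext ρ
    have hc : ρ (gen m n 0) * ρ (gen m n 1) = ρ (gen m n 1) * ρ (gen m n 0) ↔
        ∀ i j, ((ρ (gen m n 0)).1 * (ρ (gen m n 1)).1 -
          (ρ (gen m n 1)).1 * (ρ (gen m n 0)).1) i j = 0 :=
      ⟨fun h i j => congrFun (congrFun (sub_eq_zero.2 (congrArg Subtype.val h)) i) j,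
        fun h => Subtype.ext (sub_eq_zero.1 (Matrix.ext h))⟩
    rw [Set.mem_ofPred_eq, hasAbelianImage_iff, hc]
    push Not
    simp only [Set.mem_iUnion, Set.mem_ofPred_eq]
    rfl
  rw [h]
  refine isOpen_iUnion fun i => isOpen_iUnion fun j => isOpen_ne_zero
    (f := fun x => ((Matrix.of fun i j =>
      x (0, i, j)) * (Matrix.of fun i j => x (1, i, j)) - (Matrix.of fun i j =>
      x (1, i, j)) * (Matrix.of fun i j => x (0, i, j))) i j) ?_
  simp only [Matrix.mul_apply, Fin.sum_univ_two, Matrix.of_apply, Matrix.sub_apply]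
  fun_prop

/-- Here X is diagonal with distinct entries, and Y₀₁ = 1. -/
theorem chart_not_hasAbelianImage (hp : p ∈ eigenPairs m n) :
    ¬ HasAbelianImage (chart hp ![0, 0, 1]) := by
  rw [hasAbelianImage_iff, chart_gen_zero, chart_gen_one]
  intro h
  have h0 := congrArg Subtype.val h
  rw [coe_mul, coe_mul] at h0
  have h1 := congrFun (congrFun h0 0) 1
  simp [triMatrix, Matrix.mul_apply] at h1
  refine val_sub_inv_ne_zero hp.1 ?_
  rw [Units.val_inv_eq_inv_val]
  linear_combination h1

theorem redComponent_subset_closure_redMetabelian (hp : p ∈ eigenPairs m n) :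
    redComponent m n p ⊆ closure (redMetabelian m n) :=
  (redComponent_subset_closure_inter isOpen_not_hasAbelianImage
    ⟨_, chart_mem hp _, chart_not_hasAbelianImage hp⟩ hp).trans
    (closure_mono fun _ hρ => mem_redMetabelian_iff.2
      ⟨isReducible_of_mem_redComponent hp.1 hρ.1, hρ.2⟩)

theorem closure_redMetabelian (hm : m ≠ 0) (hn : n ≠ 0) :
    closure (redMetabelian m n) = ⋃ p ∈ eigenPairs m n, redComponent m n p := by
  refine Set.Subset.antisymm (((finite_eigenPairs hm hn).isClosed_biUnion
    fun p _ => isClosed_redComponent p).closure_subset_iff.2 fun ρ hρ => ?_)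
    (Set.iUnion₂_subset fun p hp => redComponent_subset_closure_redMetabelian hp)
  obtain ⟨p, hp, h⟩ := exists_eigenPair hm hn hρ
  exact Set.mem_biUnion hp h

/-! ### Characters -/

/-- The trace of the expanded equation (Y - c)(X - a⁻¹) = 0 is linear in tr XY, and all its other
terms are known. -/
theorem charMap_of_mem {ρ : Rep m n} (hρ : ρ ∈ redComponent m n p) :
    charMap ρ = ![(p.1 : ℂ) + ↑p.1⁻¹, p.2 + ↑p.2⁻¹, p.1 * p.2 + ↑p.1⁻¹ * ↑p.2⁻¹] := by
  obtain ⟨hX, hY, hXY⟩ := hρ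
  have h := congrArg Matrix.trace hXY
  simp only [sub_mul, mul_sub, smul_mul_assoc, mul_smul_comm, one_mul, mul_one, Matrix.trace_sub,
    Matrix.trace_smul, hX, hY, Matrix.trace_one, Matrix.trace_zero, smul_eq_mul, Fintype.card_fin,
    Nat.cast_ofNat] at h
  rw [Matrix.trace_mul_comm, ← coe_mul, ← map_mul] at h
  rw [charMap, hX, hY]
  congr 3
  linear_combination h

theorem image_charMap_redComponent (hp : p ∈ eigenPairs m n) :
    charMap '' redComponent m n p =
      {![(p.1 : ℂ) + ↑p.1⁻¹, p.2 + ↑p.2⁻¹, p.1 * p.2 + ↑p.1⁻¹ * ↑p.2⁻¹]} := by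
  refine Set.eq_singleton_iff_nonempty_unique_mem.2 ⟨⟨_, _, chart_mem hp 0, rfl⟩, ?_⟩
  rintro _ ⟨ρ, hρ, rfl⟩
  exact charMap_of_mem hρ

theorem eq_or_eq_inv_of_add_inv_eq {a b : ℂˣ} (h : (a : ℂ) + ↑a⁻¹ = b + ↑b⁻¹) :
    a = b ∨ a = b⁻¹ := by
  have h1 : ((a : ℂ) - b) * (a - ↑b⁻¹) = 0 := by
    linear_combination (a : ℂ) * h - a.mul_inv + b.mul_inv
  rcases mul_eq_zero.1 h1 with h | h
  · exact Or.inl (Units.ext (sub_eq_zero.1 h))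
  · exact Or.inr (Units.ext (sub_eq_zero.1 h))

/-- The first two traces determine each eigenvalue up to inversion. Inverting just one of them
changes the third trace by ±(a - a⁻¹)(c - c⁻¹) ≠ 0. -/
theorem image_charMap_eq_iff {q : ℂˣ × ℂˣ} (hp : p ∈ eigenPairs m n) (hq : q ∈ eigenPairs m n) :
    charMap '' redComponent m n q = charMap '' redComponent m n p ↔ q = p ∨ q = p⁻¹ := by
  rw [image_charMap_redComponent hp, image_charMap_redComponent hq, Set.singleton_eq_singleton_iff]
  constructor
  · intro h
    have h0 : (q.1 : ℂ) + ↑q.1⁻¹ = p.1 + ↑p.1⁻¹ := congrFun h 0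
    have h1 : (q.2 : ℂ) + ↑q.2⁻¹ = p.2 + ↑p.2⁻¹ := congrFun h 1
    have h2 : (q.1 : ℂ) * q.2 + ↑q.1⁻¹ * ↑q.2⁻¹ = p.1 * p.2 + ↑p.1⁻¹ * ↑p.2⁻¹ := congrFun h 2
    have hne := mul_ne_zero (val_sub_inv_ne_zero hp.1) (val_sub_inv_ne_zero hp.2.1)
    rcases eq_or_eq_inv_of_add_inv_eq h0 with h3 | h3 <;>
      rcases eq_or_eq_inv_of_add_inv_eq h1 with h4 | h4
    · exact Or.inl (Prod.ext h3 h4)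
    · rw [h3, h4, inv_inv] at h2
      exact absurd (by linear_combination -h2) hne
    · rw [h3, h4, inv_inv] at h2
      exact absurd (by linear_combination -h2) hne
    · exact Or.inr (Prod.ext h3 h4)
  · rintro (rfl | rfl)
    · rfl
    · simp only [Prod.fst_inv, Prod.snd_inv, inv_inv]
      congr 1
      · ring
      · congr 1
        · ring
        · congr 1
          ring

theorem inv_mem_eigenPairs (hp : p ∈ eigenPairs m n) : p⁻¹ ∈ eigenPairs m n := by
  obtain ⟨h1, h2, h3, h4⟩ := hp
  refine ⟨?_, ?_, ?_, ?_⟩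
  · simpa using h1
  · simpa using h2
  · simpa using h3
  · simpa using h4

theorem inv_ne_self_of_mem (hp : p ∈ eigenPairs m n) : p⁻¹ ≠ p := by
  intro h
  refine hp.1 ?_
  rw [pow_two, mul_eq_one_iff_eq_inv, ← Prod.fst_inv, h]

/-- The characters leave only p = q and p = q⁻¹. In the second case the point with X diagonal and
Y₀₁ = 1 violates the equation of q: its upper right entry is q.1 - q.1⁻¹. -/
theorem redComponent_subset_iff {q : ℂˣ × ℂˣ} (hp : p ∈ eigenPairs m n)
    (hq : q ∈ eigenPairs m n) (h : redComponent m n p ⊆ redComponent m n q) : p = q := by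
  have hch : charMap '' redComponent m n p = charMap '' redComponent m n q := by
    have h1 := Set.image_mono (f := charMap) h
    rw [image_charMap_redComponent hp, image_charMap_redComponent hq] at h1 ⊢
    rw [Set.singleton_subset_singleton.1 h1]
  rcases (image_charMap_eq_iff hq hp).1 hch with h1 | rfl
  · exact h1
  · have h2 := (h (chart_mem hp ![0, 0, 1])).2.2
    rw [chart_gen_zero, chart_gen_one] at h2
    have h3 := congrFun (congrFun h2 0) 1
    simp [triMatrix, Matrix.mul_apply] at h3
    exact absurd (by simpa [sub_eq_zero] using h3) (val_sub_inv_ne_zero hq.1)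

theorem irredComponentsOf_closure_redMetabelian (hm : m ≠ 0) (hn : n ≠ 0) :
    irredComponentsOf (closure (redMetabelian m n)) = redComponent m n '' eigenPairs m n := by
  rw [closure_redMetabelian hm hn]
  exact irredComponentsOf_biUnion (finite_eigenPairs hm hn) (fun p _ => isClosed_redComponent p)
    (fun p hp => isIrreducible_redComponent hp) (fun p hp q hq => redComponent_subset_iff hp hq)

theorem injOn_redComponent : Set.InjOn (redComponent m n) (eigenPairs m n) :=
  fun _ hp _ hq h => redComponent_subset_iff hp hq h.le

theorem ncard_same_character (hm : m ≠ 0) (hn : n ≠ 0) (hp : p ∈ eigenPairs m n) :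
    {W ∈ irredComponentsOf (closure (redMetabelian m n)) |
      charMap '' W = charMap '' redComponent m n p}.ncard = 2 := by
  rw [Set.ncard_eq_two]
  refine ⟨redComponent m n p, redComponent m n p⁻¹, fun h => inv_ne_self_of_mem hp
    (injOn_redComponent hp (inv_mem_eigenPairs hp) h).symm, ?_⟩
  ext W
  rw [irredComponentsOf_closure_redMetabelian hm hn]
  constructor
  · rintro ⟨⟨q, hq, rfl⟩, h⟩
    rcases (image_charMap_eq_iff hp hq).1 h with rfl | rfl
    · exact Or.inl rfl
    · exact Or.inr rfl
  · rintro (rfl | rfl)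
    · exact ⟨⟨p, hp, rfl⟩, rfl⟩
    · exact ⟨⟨_, inv_mem_eigenPairs hp, rfl⟩,
        (image_charMap_eq_iff hp (inv_mem_eigenPairs hp)).2 (Or.inr rfl)⟩

/-! ### Abelian and irreducible representations over the common character -/

theorem exists_ab_charMap (hp : p ∈ eigenPairs m n) :
    ∃ ρ ∈ redComponent m n p, ρ ∈ ab m n := by
  refine ⟨chart hp 0, chart_mem hp _, hasAbelianImage_iff.2 ?_⟩
  rw [chart_gen_zero, chart_gen_one]
  refine Subtype.ext ?_
  rw [coe_mul, coe_mul]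
  ext i j
  fin_cases i <;> fin_cases j <;> simp [triMatrix, Matrix.mul_apply, mul_comm]

/-- X stays diagonal while the c-eigenvector (1, u) of Y is tilted; the traces, and so the relation,
are preserved. The eigenvectors of X lie on the axes, and Y has Y₀₁ = 1 and Y₁₀ = u (c - c⁻¹ - u),
so no axis is stable for general u. At u = 0 the representation lies in the component. -/
theorem exists_closure_irr_charMap (hp : p ∈ eigenPairs m n) :
    ∃ ρ ∈ redComponent m n p, ρ ∈ closure (irr m n) := by
  let F : (Unit → ℂ) → Rep m n := fun u =>
    repOf (triMatrix p.1 0 0) (triMatrix p.2 (u ()) 1)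
      (zpow_eq_zpow_of_mem hp (trace_triMatrix _ _ _) (trace_triMatrix _ _ _))
  have h0 : F 0 = chart hp ![0, 0, 1] := rfl
  have hF : Continuous F := by
    refine continuous_of_polynomial fun k i j => ?_
    fin_cases k
    · simp only [F, Fin.zero_eta, repOf_gen_zero]
      exact IsPolynomialFun.const _
    · simp only [F, Fin.mk_one, repOf_gen_one]
      exact isPolynomialFun_triMatrix _ (by fun_prop) (by fun_prop) i j
  refine ⟨F 0, h0 ▸ chart_mem hp _, hF.mem_closure_of_isOpen
    (U := {u | u () * ((p.2 : ℂ) - ↑p.2⁻¹ - u ()) ≠ 0})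
    (zariskiTopology.isOpen_ne_zero (by fun_prop)) ?_ ?_ 0⟩
  · have h := val_sub_inv_ne_zero hp.2.1
    refine ⟨fun _ => ((p.2 : ℂ) - ↑p.2⁻¹) / 2, ?_⟩
    have : ((p.2 : ℂ) - ↑p.2⁻¹) / 2 * ((p.2 : ℂ) - ↑p.2⁻¹ - ((p.2 : ℂ) - ↑p.2⁻¹) / 2) =
      (((p.2 : ℂ) - ↑p.2⁻¹) / 2) ^ 2 := by ring
    simp only [Set.mem_ofPred_eq, this]
    exact pow_ne_zero _ (div_ne_zero h two_ne_zero)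
  · intro u hu
    rw [irr, Set.mem_ofPred_eq, isReducible_iff]
    rintro ⟨v, hv, ⟨e, he⟩, ⟨f, hf⟩⟩
    simp only [F, repOf_gen_zero, repOf_gen_one] at he hf
    have he0 := congrFun he 0
    have he1 := congrFun he 1
    have hf0 := congrFun hf 0
    have hf1 := congrFun hf 1
    simp [triMatrix, Matrix.mulVec, dotProduct] at he0 he1 hf0 hf1
    have hv1 : v 0 = 0 ∨ v 1 = 0 := by
      rcases he0 with h0 | h0
      · rcases he1 with h1 | h1
        · refine absurd ?_ (val_sub_inv_ne_zero hp.1)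
          rw [Units.val_inv_eq_inv_val, h1, h0, sub_self]
        · exact Or.inr h1
      · exact Or.inl h0
    rcases hv1 with h | h
    · have h1 : v 1 = 0 := by simpa [h] using hf0
      exact hv (funext fun i => by fin_cases i <;> simp [h, h1])
    · have h1 : v 0 = 0 := by
        rw [h, mul_zero, mul_zero, add_zero] at hf1
        exact (mul_eq_zero.1 hf1).resolve_left (by simpa using hu)
      exact hv (funext fun i => by fin_cases i <;> simp [h, h1])

end TorusGroup

-- Regular maps and products of matrix entries

/-- A map whose coordinates are quotients of polynomials with a common denominator is regular. -/
theorem isRegularOn_of_div {σ τ : Type} {f F : (σ → ℂ) → (τ → ℂ)} {q : (σ → ℂ) → ℂ}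
    {U : Set (σ → ℂ)} (hq : IsPolynomialFun q) (hF : ∀ j, IsPolynomialFun fun x => F x j)
    (hq0 : ∀ x ∈ U, q x ≠ 0) (h : ∀ x ∈ U, ∀ j, f x j = F x j / q x) : IsRegularOn f U := by
  intro x hx j
  obtain ⟨Q, hQ⟩ := hq
  obtain ⟨P, hP⟩ := hF j
  refine ⟨P, Q, by rw [hQ]; exact hq0 x hx, fun y hy _ => ?_⟩
  rw [hP, hQ, h y hy]

/-- The products of two entries of a matrix. -/
def entryProducts (A : Matrix (Fin 2) (Fin 2) ℂ) : (Fin 2 × Fin 2) × (Fin 2 × Fin 2) → ℂ :=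
  fun k => A k.1.1 k.1.2 * A k.2.1 k.2.2

theorem mem_pslVariety_iff {y : (Fin 2 × Fin 2) × (Fin 2 × Fin 2) → ℂ} :
    y ∈ pslVariety ↔ ∃ A : SL(2, ℂ), entryProducts A.1 = y := by
  constructor
  · rintro ⟨x, rfl⟩
    obtain ⟨A, rfl⟩ := QuotientGroup.mk_surjective x
    exact ⟨A, rfl⟩
  · rintro ⟨A, rfl⟩
    exact ⟨QuotientGroup.mk A, rfl⟩

namespace TorusGroup

open Matrix Matrix.SpecialLinearGroup

attribute [local instance] zariskiTopology

variable {m n : ℤ} {p : ℂˣ × ℂˣ}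

/-! ### The dimension of the components -/

/-- The open sets where the conjugate by `upper u` has X₀₁ ≠ 0 cover the component. On each, the
chart coordinates `φ` are continuous and a continuous map takes them back to the inclusion, so `φ`
induces the topology from ℂ³. -/
theorem topologicalKrullDim_redComponent_le (hp : p ∈ eigenPairs m n) :
    topologicalKrullDim (redComponent m n p) ≤ 3 := by
  have hconj (u : ℂ) : Continuous fun z : redComponent m n p => coords (conjRep (upper u) z.1) :=
    continuous_coords.comp ((continuous_conjRep _).comp continuous_subtype_val)
  have hopen (u : ℂ) : IsOpen
      {z : redComponent m n p | coords (conjRep (upper u) z.1) (0, 0, 1) ≠ 0} := by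
    have h := zariskiTopology.isOpen_ne_zero
      (IsPolynomialFun.coord ((0, 0, 1) : Fin 2 × Fin 2 × Fin 2))
    exact h.preimage (hconj u)
  refine topologicalKrullDim_le_of_isOpen_cover hopen (fun z => ?_) fun u => ?_
  · obtain ⟨u, hu⟩ := exists_conj_upper_ne_zero hp.1 z.2.1
    exact ⟨u, hu⟩
  let U := {z : redComponent m n p | coords (conjRep (upper u) z.1) (0, 0, 1) ≠ 0}
  let φ : U → (Fin 3 → ℂ) := fun z =>
    ![((p.1 : ℂ) - coords (conjRep (upper u) z.1.1) (0, 0, 0)) /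
        coords (conjRep (upper u) z.1.1) (0, 0, 1),
      coords (conjRep (upper u) z.1.1) (0, 0, 1), coords (conjRep (upper u) z.1.1) (1, 0, 1)]
  have hφ : Continuous φ := by
    refine zariskiTopology.continuous_of_rational ((hconj u).comp continuous_subtype_val)
      (q := fun x => x (0, 0, 1)) (F := fun x => ![(p.1 : ℂ) - x (0, 0, 0),
        x (0, 0, 1) * x (0, 0, 1), x (1, 0, 1) * x (0, 0, 1)]) (by fun_prop) (fun j => ?_)
      (fun z => z.2) fun z j => ?_
    · fin_cases j <;> simp <;> fun_prop
    · have hz : coords (conjRep (upper u) z.1.1) (0, 0, 1) ≠ 0 := z.2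
      fin_cases j
      · exact div_mul_cancel₀ _ hz
      · rfl
      · rfl
  have hψ : Continuous (conjRep (upper u)⁻¹ ∘ chart hp) :=
    (continuous_conjRep _).comp (continuous_chart hp)
  have hcomp : (conjRep (upper u)⁻¹ ∘ chart hp) ∘ φ = Subtype.val ∘ Subtype.val := by
    funext z
    have h : conjRep (upper u) z.1.1 = chart hp (φ z) :=
      eq_chart hp (conjRep_mem_redComponent _ z.1.2) z.2
    rw [Function.comp_apply, Function.comp_apply, ← h, conjRep_inv_conjRep]
    rfl
  have hind : Topology.IsInducing φ := by
    refine Topology.IsInducing.of_comp hφ hψ ?_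
    rw [hcomp]
    exact Topology.IsInducing.subtypeVal.comp Topology.IsInducing.subtypeVal
  exact hind.topologicalKrullDim_le.trans (zariskiTopology.topologicalKrullDim_le 3)

theorem le_topologicalKrullDim_redComponent (hp : p ∈ eigenPairs m n) :
    3 ≤ topologicalKrullDim (redComponent m n p) := by
  -- Coordinates are freed one at a time: X₀₁, then Y₀₁, then the slope s of the eigenvector. Stage
  -- i keeps those with `ord j < i`; the entry `e i` below vanishes identically at stage i but not
  -- at stage i + 1.
  let ord : Fin 3 → ℕ := ![2, 0, 1]
  let L : ℕ → (Fin 3 → ℂ) → (Fin 3 → ℂ) := fun i x j => if ord j < i then x j else 0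
  let F : (Fin 3 → ℂ) → redComponent m n p := fun x => ⟨chart hp x, chart_mem hp x⟩
  have hF : Continuous F := (continuous_chart hp).subtype_mk _
  have hL (i : ℕ) : Continuous (L i) := by
    refine zariskiTopology.continuous_of_polynomial fun j => ?_
    by_cases h : ord j < i
    · simp only [L, h, if_true]; fun_prop
    · simp only [L, h, if_false]; fun_prop
  let e : Fin 3 → Fin 2 × Fin 2 × Fin 2 := ![(0, 0, 1), (1, 0, 1), (0, 1, 0)]
  refine le_topologicalKrullDim_of_chain (n := 3) (fun i => Set.range (F ∘ L i)) (fun i => ?_)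
    (fun i => ?_) fun i => ⟨{z | coords z.1 (e i) = 0},
      (isClosed_eq_zero (IsPolynomialFun.coord (e i))).preimage continuous_subtype_val, ?_, ?_⟩
  · rw [← Set.image_univ]
    exact (IrreducibleSpace.isIrreducible_univ _).image _ (hF.comp (hL i)).continuousOn
  · rintro _ ⟨x, rfl⟩
    refine ⟨L i x, congrArg F (funext fun j => ?_)⟩
    by_cases h : ord j < i
    · simp [L, h, h.trans (Nat.lt_succ_self _)]
    · simp [L, h]
  · rintro _ ⟨x, rfl⟩
    change (chart hp (L i x) (gen m n (e i).1)).1 (e i).2.1 (e i).2.2 = 0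
    fin_cases i
    · simp [e, chart_gen_zero, triMatrix, L, ord]
    · simp [e, chart_gen_one, triMatrix, L, ord]
    · simp [e, chart_gen_zero, triMatrix, L, ord]
  · intro h
    have h1 := val_sub_inv_ne_zero hp.1
    rw [Units.val_inv_eq_inv_val] at h1
    have hx (x : Fin 3 → ℂ) :
        (chart hp (L (i + 1) x) (gen m n (e i).1)).1 (e i).2.1 (e i).2.2 = 0 :=
      h ⟨x, rfl⟩
    fin_cases i
    · simpa [e, chart_gen_zero, triMatrix, L, ord] using hx ![0, 1, 0]
    · simpa [e, chart_gen_one, triMatrix, L, ord] using hx ![0, 0, 1]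
    · refine h1 ?_
      simpa [e, chart_gen_zero, triMatrix, L, ord] using hx ![1, 0, 0]

theorem topologicalKrullDim_redComponent (hp : p ∈ eigenPairs m n) :
    topologicalKrullDim (redComponent m n p) = 3 :=
  (topologicalKrullDim_redComponent_le hp).antisymm (le_topologicalKrullDim_redComponent hp)

/-! ### The components are birational to `PSL(2, ℂ)` -/

/-- Three rational coordinates `α, β, γ` determine a matrix up to scalars; this is the inverse of
`A ↦ (A₀₀², A₀₀ A₀₁, A₀₀ A₁₀)` up to the factor `A₀₀³`. -/
def rationalMatrix (α β γ : ℂ) : Matrix (Fin 2) (Fin 2) ℂ :=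
  !![α ^ 2, α * β; α * γ, α + β * γ]

theorem isPolynomialFun_rationalMatrix {σ : Type} {α β γ : (σ → ℂ) → ℂ} (hα : IsPolynomialFun α)
    (hβ : IsPolynomialFun β) (hγ : IsPolynomialFun γ) (i j : Fin 2) :
    IsPolynomialFun fun x => rationalMatrix (α x) (β x) (γ x) i j := by
  fin_cases i <;> fin_cases j <;> simp [rationalMatrix] <;> fun_prop

/-- The determinant of `rationalMatrix α β γ` is α³. Dividing by a square root α r of α³ gives a
matrix in SL(2, ℂ), and the choice of root disappears in products of two entries. -/
theorem entryProducts_rationalMatrix_mem {α β γ : ℂ} (hα : α ≠ 0) :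
    (fun k => entryProducts (rationalMatrix α β γ) k / α ^ 3) ∈ pslVariety := by
  obtain ⟨r, hr⟩ := IsAlgClosed.exists_pow_nat_eq α (n := 2) (by norm_num)
  have hr0 : r ≠ 0 := by
    rintro rfl
    exact hα (by simpa using hr.symm)
  refine mem_pslVariety_iff.2 ⟨⟨(α * r)⁻¹ • rationalMatrix α β γ, ?_⟩, ?_⟩
  · rw [Matrix.det_smul, rationalMatrix, Matrix.det_fin_two_of, ← hr, Fintype.card_fin]
    field_simp
    ring
  · funext k
    simp only [entryProducts, Matrix.smul_apply, smul_eq_mul]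
    rw [show α ^ 3 = (α * r) ^ 2 by rw [mul_pow, hr]; ring]
    field_simp

theorem rationalMatrix_of_entries (A : SL(2, ℂ)) :
    rationalMatrix (A.1 0 0 * A.1 0 0) (A.1 0 0 * A.1 0 1) (A.1 0 0 * A.1 1 0) =
      A.1 0 0 ^ 3 • A.1 := by
  have hdet := A.2
  rw [Matrix.det_fin_two] at hdet
  ext i j
  fin_cases i <;> fin_cases j <;> simp [rationalMatrix]
  · ring
  · ring
  · ring
  · linear_combination -(A.1 0 0 ^ 2) * hdet

/-- The numerators of the entries of `triMatrix a (t / β) b` over the denominator `β ^ 2`. -/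
def triNumerators (a : ℂˣ) (t β b : ℂ) : Matrix (Fin 2) (Fin 2) ℂ :=
  !![a * β ^ 2 - b * t * β, b * β ^ 2;
    t * (((a : ℂ) - ↑a⁻¹) * β - b * t), (↑a⁻¹ : ℂ) * β ^ 2 + b * t * β]

theorem triMatrix_div (a : ℂˣ) (t b : ℂ) {β : ℂ} (hβ : β ≠ 0) (i j : Fin 2) :
    (triMatrix a (t / β) b).1 i j = triNumerators a t β b i j / β ^ 2 := by
  rw [eq_div_iff (pow_ne_zero 2 hβ)]
  fin_cases i <;> fin_cases j <;> simp [triMatrix, triNumerators] <;> field_simp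

theorem isPolynomialFun_triNumerators {σ : Type} (a : ℂˣ) {t β b : (σ → ℂ) → ℂ}
    (ht : IsPolynomialFun t) (hβ : IsPolynomialFun β) (hb : IsPolynomialFun b) (i j : Fin 2) :
    IsPolynomialFun fun x => triNumerators a (t x) (β x) (b x) i j := by
  fin_cases i <;> fin_cases j <;> simp [triNumerators] <;> fun_prop

/-- X₀₀ - a⁻¹ will be the coordinate α = A₀₀² on PSL(2, ℂ), inverted in `toPSL`; X₀₁ will be β = A₀₀
A₀₁, inverted in `ofPSL`. -/
theorem isDenseOpenIn_redComponent (hp : p ∈ eigenPairs m n) :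
    IsDenseOpenIn (coords '' redComponent m n p ∩
      {x | (x (0, 0, 0) - ↑p.1⁻¹) * x (0, 0, 1) ≠ 0}) (coords '' redComponent m n p) := by
  have hpoly : IsPolynomialFun fun x : Fin 2 × Fin 2 × Fin 2 → ℂ =>
    (x (0, 0, 0) - ↑p.1⁻¹) * x (0, 0, 1) := by fun_prop
  refine ⟨⟨_, zariskiTopology.isOpen_ne_zero hpoly, rfl⟩, ?_⟩
  rintro _ ⟨ρ, hρ, rfl⟩
  refine map_mem_closure continuous_coords
    (redComponent_subset_closure_inter (isOpen_ne_zero hpoly) ?_ hp hρ) ?_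
  · refine ⟨chart hp ![0, 1, 0], chart_mem hp _, ?_⟩
    have h1 := val_sub_inv_ne_zero hp.1
    rw [Units.val_inv_eq_inv_val] at h1
    simpa [coords, chart_gen_zero, triMatrix] using h1
  · exact fun σ hσ => ⟨⟨σ, hσ.1, rfl⟩, hσ.2⟩

theorem isDenseOpenIn_pslVariety :
    IsDenseOpenIn (pslVariety ∩ {y | y ((0, 0), (0, 0)) * y ((0, 0), (0, 1)) ≠ 0})
      pslVariety := by
  have hpoly : IsPolynomialFun fun y : (Fin 2 × Fin 2) × (Fin 2 × Fin 2) → ℂ =>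
    y ((0, 0), (0, 0)) * y ((0, 0), (0, 1)) := by fun_prop
  refine ⟨⟨_, zariskiTopology.isOpen_ne_zero hpoly, rfl⟩, ?_⟩
  intro y hy
  obtain ⟨A, rfl⟩ := mem_pslVariety_iff.1 hy
  -- A polynomial curve in SL(2, ℂ) through A at s = 0. The first row of A is nonzero, so neither
  -- entry of the first row of `B s` vanishes identically.
  let B : (Unit → ℂ) → SL(2, ℂ) := fun s =>
    A * ⟨!![1, s (); s (), 1 + s () ^ 2], by rw [Matrix.det_fin_two_of]; ring⟩
  have hB0 (s : Unit → ℂ) (i : Fin 2) : (B s).1 i 0 = A.1 i 0 + A.1 i 1 * s () := by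
    change (A.1 * !![1, s (); s (), 1 + s () ^ 2]) i 0 = _
    simp [Matrix.mul_apply]
  have hB1 (s : Unit → ℂ) (i : Fin 2) :
      (B s).1 i 1 = A.1 i 0 * s () + A.1 i 1 * (1 + s () ^ 2) := by
    change (A.1 * !![1, s (); s (), 1 + s () ^ 2]) i 1 = _
    simp [Matrix.mul_apply]
  have hB (i j : Fin 2) : IsPolynomialFun fun s => (B s).1 i j := by
    fin_cases j
    · simp only [Fin.zero_eta, hB0]; fun_prop
    · simp only [Fin.mk_one, hB1]; fun_prop
  have hcont : Continuous fun s => entryProducts (B s).1 :=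
    zariskiTopology.continuous_of_polynomial fun k => (hB _ _).mul (hB _ _)
  have h0 : B 0 = A := by
    refine Subtype.ext (Matrix.ext fun i j => ?_)
    fin_cases j <;> simp [hB0, hB1]
  rw [← h0]
  refine hcont.mem_closure_of_isOpen (U := {s | (B s).1 0 0 * (B s).1 0 1 ≠ 0})
    (zariskiTopology.isOpen_ne_zero ((hB 0 0).mul (hB 0 1))) ?_ (fun s hs => ?_) 0
  · simp only [hB0, hB1]
    by_cases hq : A.1 0 1 = 0
    · have hdet := A.2
      rw [Matrix.det_fin_two, hq] at hdet
      have hp0 : A.1 0 0 ≠ 0 := fun h => by simp [h] at hdet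
      exact ⟨fun _ => 1, by simpa [hq] using hp0⟩
    · by_cases hp0 : A.1 0 0 = 0
      · refine ⟨fun _ => 1, ?_⟩
        simp [hp0, hq]
      · exact ⟨fun _ => 0, by simpa using ⟨hp0, hq⟩⟩
  · refine ⟨mem_pslVariety_iff.2 ⟨_, rfl⟩, ?_⟩
    have hs : (B s).1 0 0 * (B s).1 0 1 ≠ 0 := hs
    have h1 := left_ne_zero_of_mul hs
    exact mul_ne_zero (mul_ne_zero h1 h1) hs

/-- The rational map from the component of `p` to `PSL(2, ℂ)`. -/
noncomputable def toPSL (a : ℂˣ) (x : Fin 2 × Fin 2 × Fin 2 → ℂ) : (Fin 2 × Fin 2) × (Fin 2 × Fin 2) → ℂ :=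
  fun k => entryProducts (rationalMatrix (x (0, 0, 0) - ↑a⁻¹) (x (0, 0, 1)) (x (1, 0, 1))) k /
    (x (0, 0, 0) - ↑a⁻¹) ^ 3

/-- The rational map from `PSL(2, ℂ)` to the component of `p`. -/
noncomputable def ofPSL (hp : p ∈ eigenPairs m n) (y : (Fin 2 × Fin 2) × (Fin 2 × Fin 2) → ℂ) :
    Fin 2 × Fin 2 × Fin 2 → ℂ :=
  -- The slope s solves a - β s = α + a⁻¹, so that X₀₀ - a⁻¹ = α.
  coords (chart hp ![((p.1 : ℂ) - ↑p.1⁻¹ - y ((0, 0), (0, 0))) / y ((0, 0), (0, 1)),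
    y ((0, 0), (0, 1)), y ((0, 0), (1, 0))])

theorem toPSL_apply (a : ℂˣ) {x : Fin 2 × Fin 2 × Fin 2 → ℂ} (hx : x (0, 0, 0) - ↑a⁻¹ ≠ 0) :
    toPSL a x ((0, 0), (0, 0)) = x (0, 0, 0) - ↑a⁻¹ ∧
      toPSL a x ((0, 0), (0, 1)) = x (0, 0, 1) ∧ toPSL a x ((0, 0), (1, 0)) = x (1, 0, 1) := by
  simp only [toPSL, entryProducts, rationalMatrix]
  refine ⟨?_, ?_, ?_⟩ <;> rw [div_eq_iff (pow_ne_zero 3 hx)] <;> simp <;> ring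

theorem ofPSL_zero (hp : p ∈ eigenPairs m n) (y : (Fin 2 × Fin 2) × (Fin 2 × Fin 2) → ℂ)
    (i j : Fin 2) : ofPSL hp y (0, i, j) = (triMatrix p.1
      (((p.1 : ℂ) - ↑p.1⁻¹ - y ((0, 0), (0, 0))) / y ((0, 0), (0, 1))) (y ((0, 0), (0, 1)))).1 i j := by
  simp only [ofPSL, coords, chart_gen_zero]
  rfl

theorem ofPSL_one (hp : p ∈ eigenPairs m n) (y : (Fin 2 × Fin 2) × (Fin 2 × Fin 2) → ℂ)
    (i j : Fin 2) : ofPSL hp y (1, i, j) = (triMatrix p.2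
      (((p.1 : ℂ) - ↑p.1⁻¹ - y ((0, 0), (0, 0))) / y ((0, 0), (0, 1))) (y ((0, 0), (1, 0)))).1 i j := by
  simp only [ofPSL, coords, chart_gen_one]
  rfl

theorem ofPSL_apply (hp : p ∈ eigenPairs m n) {y : (Fin 2 × Fin 2) × (Fin 2 × Fin 2) → ℂ}
    (hy : y ((0, 0), (0, 1)) ≠ 0) :
    ofPSL hp y (0, 0, 0) - ↑p.1⁻¹ = y ((0, 0), (0, 0)) ∧
      ofPSL hp y (0, 0, 1) = y ((0, 0), (0, 1)) ∧ ofPSL hp y (1, 0, 1) = y ((0, 0), (1, 0)) := by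
  rw [ofPSL_zero, ofPSL_zero, ofPSL_one]
  refine ⟨?_, by simp [triMatrix], by simp [triMatrix]⟩
  simp only [triMatrix, Matrix.of_apply, Matrix.cons_val', Matrix.cons_val_zero]
  rw [mul_div_cancel₀ _ hy]
  ring

theorem isRegularOn_toPSL (a : ℂˣ) {U : Set (Fin 2 × Fin 2 × Fin 2 → ℂ)}
    (hU : ∀ x ∈ U, x (0, 0, 0) - ↑a⁻¹ ≠ 0) : IsRegularOn (toPSL a) U := by
  refine isRegularOn_of_div (q := fun x => (x (0, 0, 0) - ↑a⁻¹) ^ 3)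
    (F := fun x => entryProducts (rationalMatrix (x (0, 0, 0) - ↑a⁻¹) (x (0, 0, 1))
      (x (1, 0, 1)))) (by fun_prop) (fun k => ?_) (fun x hx => pow_ne_zero 3 (hU x hx))
    (fun x hx j => by rw [toPSL])
  exact (isPolynomialFun_rationalMatrix (by fun_prop) (by fun_prop) (by fun_prop) _ _).mul
    (isPolynomialFun_rationalMatrix (by fun_prop) (by fun_prop) (by fun_prop) _ _)

theorem isRegularOn_ofPSL (hp : p ∈ eigenPairs m n)
    {V : Set ((Fin 2 × Fin 2) × (Fin 2 × Fin 2) → ℂ)}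
    (hV : ∀ y ∈ V, y ((0, 0), (0, 1)) ≠ 0) : IsRegularOn (ofPSL hp) V := by
  refine isRegularOn_of_div (q := fun y => y ((0, 0), (0, 1)) ^ 2)
    (F := fun y k => ![triNumerators p.1 ((p.1 : ℂ) - ↑p.1⁻¹ - y ((0, 0), (0, 0)))
      (y ((0, 0), (0, 1))) (y ((0, 0), (0, 1))),
        triNumerators p.2 ((p.1 : ℂ) - ↑p.1⁻¹ - y ((0, 0), (0, 0)))
      (y ((0, 0), (0, 1))) (y ((0, 0), (1, 0)))] k.1 k.2.1 k.2.2)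
    (by fun_prop) ?_ (fun y hy => pow_ne_zero 2 (hV y hy)) (fun y hy => ?_)
  · rintro ⟨k, i, j⟩
    fin_cases k
    · exact isPolynomialFun_triNumerators _ (by fun_prop) (by fun_prop) (by fun_prop) i j
    · exact isPolynomialFun_triNumerators _ (by fun_prop) (by fun_prop) (by fun_prop) i j
  · rintro ⟨k, i, j⟩
    fin_cases k
    · simp only [Fin.zero_eta, Matrix.cons_val_zero]
      rw [ofPSL_zero, triMatrix_div _ _ _ (hV y hy)]
    · simp only [Fin.mk_one, Matrix.cons_val_one]
      rw [ofPSL_one, triMatrix_div _ _ _ (hV y hy)]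
      rfl

theorem ofPSL_toPSL (hp : p ∈ eigenPairs m n) {ρ : Rep m n} (hρ : ρ ∈ redComponent m n p)
    (h0 : coords ρ (0, 0, 0) - ↑p.1⁻¹ ≠ 0) (h1 : coords ρ (0, 0, 1) ≠ 0) :
    ofPSL hp (toPSL p.1 (coords ρ)) = coords ρ := by
  obtain ⟨e0, e1, e2⟩ := toPSL_apply p.1 h0
  rw [ofPSL, e0, e1, e2, sub_sub_sub_cancel_right]
  exact congrArg coords (eq_chart hp hρ h1).symm

/-- The matrix A is recovered up to the factor A₀₀³, whose square is the denominator α³ with α =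
A₀₀². -/
theorem toPSL_ofPSL (hp : p ∈ eigenPairs m n) (A : SL(2, ℂ)) (hA : A.1 0 0 * A.1 0 1 ≠ 0) :
    toPSL p.1 (ofPSL hp (entryProducts A.1)) = entryProducts A.1 := by
  have hA0 : A.1 0 0 ≠ 0 := left_ne_zero_of_mul hA
  obtain ⟨e0, e1, e2⟩ := ofPSL_apply hp (y := entryProducts A.1) hA
  funext k
  rw [toPSL, e0, e1, e2]
  simp only [entryProducts, rationalMatrix_of_entries, Matrix.smul_apply, smul_eq_mul]
  field_simp

theorem areBirational_redComponent (hp : p ∈ eigenPairs m n) :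
    AreBirational (coords '' redComponent m n p) pslVariety := by
  refine ⟨_, _, toPSL p.1, ofPSL hp, isDenseOpenIn_redComponent hp, isDenseOpenIn_pslVariety,
    isRegularOn_toPSL p.1 fun x hx => left_ne_zero_of_mul hx.2,
    isRegularOn_ofPSL hp fun y hy => right_ne_zero_of_mul hy.2, ?_, ?_, ?_, ?_⟩
  · rintro x ⟨-, hx⟩
    have hx0 : x (0, 0, 0) - ↑p.1⁻¹ ≠ 0 := left_ne_zero_of_mul hx
    obtain ⟨e0, e1, -⟩ := toPSL_apply p.1 hx0
    refine ⟨entryProducts_rationalMatrix_mem hx0, ?_⟩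
    rw [Set.mem_ofPred_eq, e0, e1]
    exact hx
  · rintro y ⟨-, hy⟩
    obtain ⟨e0, e1, -⟩ := ofPSL_apply hp (right_ne_zero_of_mul hy)
    refine ⟨⟨_, chart_mem hp _, rfl⟩, ?_⟩
    rw [Set.mem_ofPred_eq, e0, e1]
    exact hy
  · rintro _ ⟨⟨ρ, hρ, rfl⟩, hx⟩
    exact ofPSL_toPSL hp hρ (left_ne_zero_of_mul hx) (right_ne_zero_of_mul hx)
  · rintro y ⟨hy, hy'⟩
    obtain ⟨A, rfl⟩ := mem_pslVariety_iff.1 hy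
    exact toPSL_ofPSL hp A (right_ne_zero_of_mul hy')

end TorusGroup

theorem mainTheorem6 (m n : ℤ) (hm : m ≠ 0) (hn : n ≠ 0) :
    (irredComponentsOf (closure (TorusGroup.redMetabelian m n))).Finite ∧
    (Odd (Int.gcd m n) →
      ((irredComponentsOf (closure (TorusGroup.redMetabelian m n))).ncard : ℤ) =
        2 * (|m| - 1) * (|n| - 1)) ∧
    (Even (Int.gcd m n) →
      ((irredComponentsOf (closure (TorusGroup.redMetabelian m n))).ncard : ℤ) =
        2 * ((|m| - 1) * (|n| - 1) + 1)) ∧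
    ∀ Z ∈ irredComponentsOf (closure (TorusGroup.redMetabelian m n)),
      topologicalKrullDim Z = 3 ∧
      AreBirational (TorusGroup.coords '' Z) pslVariety ∧
      (∃ P ∈ (TorusGroup.charMap '' closure (TorusGroup.irr m n)) ∩
            (TorusGroup.charMap '' TorusGroup.ab m n),
        TorusGroup.charMap '' Z = {P}) ∧
      {W ∈ irredComponentsOf (closure (TorusGroup.redMetabelian m n)) |
        TorusGroup.charMap '' W = TorusGroup.charMap '' Z}.ncard = 2 := by
  have hcomp := TorusGroup.irredComponentsOf_closure_redMetabelian hm hn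
  have hcard : (irredComponentsOf (closure (TorusGroup.redMetabelian m n))).ncard =
      (TorusGroup.eigenPairs m n).ncard := by
    rw [hcomp, TorusGroup.injOn_redComponent.ncard_image]
  refine ⟨?_, fun h => ?_, fun h => ?_, fun Z hZ => ?_⟩
  · rw [hcomp]
    exact (TorusGroup.finite_eigenPairs hm hn).image _
  · rw [hcard, TorusGroup.ncard_eigenPairs_of_odd hm hn h]
  · rw [hcard, TorusGroup.ncard_eigenPairs_of_even hm hn h]
  · rw [hcomp] at hZ
    obtain ⟨p, hp, rfl⟩ := hZ
    refine ⟨TorusGroup.topologicalKrullDim_redComponent hp,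
      TorusGroup.areBirational_redComponent hp,
      ⟨_, ⟨?_, ?_⟩, TorusGroup.image_charMap_redComponent hp⟩,
      TorusGroup.ncard_same_character hm hn hp⟩
    · obtain ⟨ρ, hρ, h⟩ := TorusGroup.exists_closure_irr_charMap hp
      exact ⟨ρ, h, TorusGroup.charMap_of_mem hρ⟩
    · obtain ⟨ρ, hρ, h⟩ := TorusGroup.exists_ab_charMap hp
      exact ⟨ρ, h, TorusGroup.charMap_of_mem hρ⟩
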